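/- Let $q_0\in L^2([0,1])$ be real-valued with $q_0(x)=q_0(1-x)$ for almost every $x$. Let $G$ be the hexagonal lattice in the plane with all edges of length $1$: its vertices are the translates $a_p,b_p$, $p\in\mathbb Z^2$, of two points $a,b$ by $p_1\vec e_1+p_2\vec e_2$, where $\vec e_1=(3/2,\sqrt3/2)$ and $\vec e_2=(0,\sqrt3)$, and each $a_p$ is joined by an edge to $b_p$, $b_{p-(1,0)}$ and $b_{p-(0,1)}$; each edge is identified with $[0,1]$. Let $H$ be the graphene Hamiltonian in $L^2(G)=\bigoplus_e L^2(e)$: it acts as $Hu=-u''+q_0u$ on each edge, and its domain consists of all $u$ with $u|_e\in H^2(e)$ for every edge $e$, with $\sum_e\|u\|_{H^2(e)}^2<\infty$, which are continuous at every vertex and for which the sum of the outgoing derivatives along the three edges at every vertex vanishes. Let $\Sigma^D$ be the spectrum of the Dirichlet operator $-\frac{d^2}{dx^2}+q_0$ in $L^2(0,1)$ with domain $\{u\in H^2(0,1): u(0)=u(1)=0\}$. For $\lambda\in\mathbb C$ let $M(\lambda)$ be the monodromy matrix, that is, the unique $2\times2$ matrix with $(\varphi(1),\varphi'(1))^T=M(\lambda)(\varphi(0),\varphi'(0))^T$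 for all solutions $\varphi\in H^2(0,1)$ of $-\varphi''+q_0\varphi=\lambda\varphi$, and let $D(\lambda)=\operatorname{tr}M(\lambda)$. Let $\lambda\in\mathbb C\setminus\Sigma^D$ (in particular, let $\lambda$ be any real number outside $\Sigma^D$). Then there is a solution $\varphi_1\in H^2(0,1)$ of $-\varphi''+q_0\varphi=\lambda\varphi$ on $(0,1)$ with $\varphi_1(0)=0$ and $\varphi_1(1)=1$; every such solution has $\varphi_1'(0)\neq0$, and $$\eta(\lambda):=\frac{\varphi_1'(1)}{\varphi_1'(0)}=\frac12D(\lambda).$$ Moreover, $\lambda$ belongs to the spectrum of $H$ if and only if there is $\theta=(\theta_1,\theta_2)\in[-\pi,\pi]^2$ with $$9\,\eta(\lambda)^2=\bigl|1+e^{i\theta_1}+e^{i\theta_2}\bigr|^2,$$ and also if and only if there is $\theta\in[-\pi,\pi]^2$ with $$9\,\eta(\lambda)^2=1+8\cos\frac{\theta_1-\theta_2}2\,\cos\frac{\theta_1}2\,\cos\frac{\theta_2}2 .$$ -/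

import Mathlib

open MeasureTheory Set
open scoped ENNReal

noncomputable section

namespace Graphene

/-! ### Spectrum of an unbounded operator -/

/-- The resolvent set of an unbounded operator `T` in a complex normed space `X`: all `z` for which
`T - z : dom T → X` has an everywhere defined bounded two-sided inverse `R`. -/
def resolventSet {X : Type*} [NormedAddCommGroup X] [NormedSpace ℂ X] (T : X →ₗ.[ℂ] X) : Set ℂ :=
  {z | ∃ R : X →L[ℂ] X,
    (∀ v : X, ∃ h : R v ∈ T.domain, T ⟨R v, h⟩ - z • R v = v) ∧
    ∀ u : T.domain, R (T u - z • (u : X)) = u}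

/-- The spectrum of an unbounded operator. -/
def spectrum {X : Type*} [NormedAddCommGroup X] [NormedSpace ℂ X] (T : X →ₗ.[ℂ] X) : Set ℂ :=
  (resolventSet T)ᶜ

/-! ### Function spaces on one edge -/

/-- Lebesgue measure on the unit interval, with which every edge is identified. -/
abbrev edgeMeasure : Measure ℝ := volume.restrict (Icc (0 : ℝ) 1)

/-- `L²` of one edge. -/
abbrev EdgeL2 : Type := Lp ℂ 2 edgeMeasure

/-- `u` belongs to the Sobolev space `H²(0,1)`, with first and second derivatives `u'` and `u''`:
on `[0,1]`, `u` is a primitive of `u'`, which is a primitive of `u'' ∈ L²`. So `u` is the `C¹`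
representative on the closed interval, `u'` is its classical (at `0` and `1` one-sided) derivative,
and `u''` is the weak second derivative. -/
structure IsH2 (u u' u'' : ℝ → ℂ) : Prop where
  memLp : MemLp u'' 2 edgeMeasure
  deriv_eq : ∀ x ∈ Icc (0 : ℝ) 1, u' x = u' 0 + ∫ t in (0 : ℝ)..x, u'' t
  eq : ∀ x ∈ Icc (0 : ℝ) 1, u x = u 0 + ∫ t in (0 : ℝ)..x, u' t

/-- The square of the `H²(0,1)`-norm. -/
def h2NormSq (u u' u'' : ℝ → ℂ) : ℝ≥0∞ :=
  ∫⁻ x, (‖u x‖ₑ ^ 2 + ‖u' x‖ₑ ^ 2 + ‖u'' x‖ₑ ^ 2) ∂edgeMeasure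

lemma enorm_add_sq_le (a b : ℂ) : ‖a + b‖ₑ ^ 2 ≤ 2 * ‖a‖ₑ ^ 2 + 2 * ‖b‖ₑ ^ 2 := by
  have hr : ‖a + b‖₊ ^ 2 ≤ 2 * ‖a‖₊ ^ 2 + 2 * ‖b‖₊ ^ 2 := by
    rw [← NNReal.coe_le_coe]
    push_cast
    have := norm_add_le a b
    nlinarith [norm_nonneg (a + b), sq_nonneg (‖a‖ - ‖b‖)]
  simp only [enorm_eq_nnnorm]
  exact_mod_cast hr

lemma intervalIntegrable_of_memLp {f : ℝ → ℂ} (hf : MemLp f 2 edgeMeasure) {x : ℝ}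
    (hx : x ∈ Icc (0 : ℝ) 1) : IntervalIntegrable f volume 0 x := by
  have h1 : IntegrableOn f (Icc 0 1) volume := hf.integrable (by norm_num)
  refine IntegrableOn.intervalIntegrable (h1.mono_set ?_)
  rw [uIcc_of_le hx.1]
  exact Icc_subset_Icc_right hx.2

lemma continuousOn_of_primitive {f g : ℝ → ℂ} (hg : MemLp g 2 edgeMeasure)
    (h : ∀ x ∈ Icc (0 : ℝ) 1, f x = f 0 + ∫ t in (0 : ℝ)..x, g t) :
    ContinuousOn f (Icc 0 1) := by
  have h1 : IntegrableOn g (uIcc (0 : ℝ) 1) volume := by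
    rw [uIcc_of_le zero_le_one]
    exact hg.integrable (by norm_num)
  have h2 := intervalIntegral.continuousOn_primitive_interval h1
  rw [uIcc_of_le zero_le_one] at h2
  exact (continuousOn_const.add h2).congr h

lemma memLp_of_continuousOn {f : ℝ → ℂ} (hf : ContinuousOn f (Icc 0 1)) :
    MemLp f 2 edgeMeasure := by
  obtain ⟨C, hC⟩ := isCompact_Icc.exists_bound_of_continuousOn hf
  refine MemLp.of_bound (hf.aestronglyMeasurable measurableSet_Icc) C ?_
  exact (ae_restrict_iff' measurableSet_Icc).2 (Filter.Eventually.of_forall hC)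

lemma ae_eq_zero_of_primitive {g : ℝ → ℂ} (hg : MemLp g 2 edgeMeasure)
    (h : ∀ x ∈ Icc (0 : ℝ) 1, ∫ t in (0 : ℝ)..x, g t = 0) : g =ᵐ[edgeMeasure] 0 := by
  have h1 := (intervalIntegrable_of_memLp hg (right_mem_Icc.2 zero_le_one)).ae_hasDerivAt_integral
  have h0 : ∀ᵐ x : ℝ, x ≠ 0 := by simp [ae_iff]
  have h2 : ∀ᵐ x : ℝ, x ≠ 1 := by simp [ae_iff]
  refine (ae_restrict_iff' measurableSet_Icc).2 ?_
  filter_upwards [h1, h0, h2] with x hx hx0 hx1 hmem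
  have hd := hx (by rwa [uIcc_of_le zero_le_one]) 0 (by simp)
  have hmem' : x ∈ Ioo (0 : ℝ) 1 :=
    ⟨lt_of_le_of_ne hmem.1 (Ne.symm hx0), lt_of_le_of_ne hmem.2 hx1⟩
  have he : (fun y => ∫ t in (0 : ℝ)..y, g t) =ᶠ[nhds x] fun _ => 0 := by
    filter_upwards [Ioo_mem_nhds hmem'.1 hmem'.2] with y hy
    exact h y (Ioo_subset_Icc_self hy)
  exact (hd.congr_of_eventuallyEq he.symm).unique (hasDerivAt_const x (0 : ℂ))

namespace IsH2

variable {u u' u'' v v' v'' : ℝ → ℂ}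

lemma continuousOn_deriv (h : IsH2 u u' u'') : ContinuousOn u' (Icc 0 1) :=
  continuousOn_of_primitive h.memLp h.deriv_eq

lemma memLp_deriv (h : IsH2 u u' u'') : MemLp u' 2 edgeMeasure :=
  memLp_of_continuousOn h.continuousOn_deriv

lemma continuousOn (h : IsH2 u u' u'') : ContinuousOn u (Icc 0 1) :=
  continuousOn_of_primitive h.memLp_deriv h.eq

lemma memLp_self (h : IsH2 u u' u'') : MemLp u 2 edgeMeasure :=
  memLp_of_continuousOn h.continuousOn

lemma zero : IsH2 0 0 0 := ⟨MemLp.zero, by simp, by simp⟩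

lemma add (h : IsH2 u u' u'') (k : IsH2 v v' v'') : IsH2 (u + v) (u' + v') (u'' + v'') where
  memLp := h.memLp.add k.memLp
  deriv_eq x hx := by
    simp only [Pi.add_apply]
    rw [intervalIntegral.integral_add (intervalIntegrable_of_memLp h.memLp hx)
      (intervalIntegrable_of_memLp k.memLp hx), h.deriv_eq x hx, k.deriv_eq x hx]
    ring
  eq x hx := by
    simp only [Pi.add_apply]
    rw [intervalIntegral.integral_add (intervalIntegrable_of_memLp h.memLp_deriv hx)
      (intervalIntegrable_of_memLp k.memLp_deriv hx), h.eq x hx, k.eq x hx]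
    ring

lemma smul (c : ℂ) (h : IsH2 u u' u'') : IsH2 (c • u) (c • u') (c • u'') where
  memLp := h.memLp.const_smul c
  deriv_eq x hx := by
    simp only [Pi.smul_apply]
    rw [intervalIntegral.integral_smul, h.deriv_eq x hx, smul_add]
  eq x hx := by
    simp only [Pi.smul_apply]
    rw [intervalIntegral.integral_smul, h.eq x hx, smul_add]

lemma ae_zero (h : IsH2 u u' u'') (h0 : u =ᵐ[edgeMeasure] 0) : u'' =ᵐ[edgeMeasure] 0 := by
  have e0 : EqOn u 0 (Icc 0 1) :=
    Measure.eqOn_Icc_of_ae_eq volume (by norm_num) h0 h.continuousOn continuousOn_const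
  have z : (0 : ℝ) ∈ Icc (0 : ℝ) 1 := by simp
  have a1 : u' =ᵐ[edgeMeasure] 0 := by
    refine ae_eq_zero_of_primitive h.memLp_deriv fun x hx => ?_
    have := h.eq x hx
    rw [e0 hx, e0 z] at this
    simpa using this.symm
  have e1 : EqOn u' 0 (Icc 0 1) :=
    Measure.eqOn_Icc_of_ae_eq volume (by norm_num) a1 h.continuousOn_deriv continuousOn_const
  refine ae_eq_zero_of_primitive h.memLp fun x hx => ?_
  have := h.deriv_eq x hx
  rw [e1 hx, e1 z] at this
  simpa using this.symm

lemma h2NormSq_add_le (h : IsH2 u u' u'') :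
    h2NormSq (u + v) (u' + v') (u'' + v'') ≤ 2 * h2NormSq u u' u'' + 2 * h2NormSq v v' v'' := by
  unfold h2NormSq
  rw [← lintegral_const_mul' _ _ (by norm_num), ← lintegral_const_mul' _ _ (by norm_num),
    ← lintegral_add_left']
  · refine lintegral_mono fun x => ?_
    calc ‖u x + v x‖ₑ ^ 2 + ‖u' x + v' x‖ₑ ^ 2 + ‖u'' x + v'' x‖ₑ ^ 2
        ≤ (2 * ‖u x‖ₑ ^ 2 + 2 * ‖v x‖ₑ ^ 2) + (2 * ‖u' x‖ₑ ^ 2 + 2 * ‖v' x‖ₑ ^ 2)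
          + (2 * ‖u'' x‖ₑ ^ 2 + 2 * ‖v'' x‖ₑ ^ 2) :=
          add_le_add (add_le_add (enorm_add_sq_le _ _) (enorm_add_sq_le _ _)) (enorm_add_sq_le _ _)
      _ = _ := by ring
  · have := h.memLp_self.aestronglyMeasurable.enorm
    have := h.memLp_deriv.aestronglyMeasurable.enorm
    have := h.memLp.aestronglyMeasurable.enorm
    fun_prop

lemma h2NormSq_smul (c : ℂ) :
    h2NormSq (c • u) (c • u') (c • u'') = ‖c‖ₑ ^ 2 * h2NormSq u u' u'' := by
  unfold h2NormSq
  rw [← lintegral_const_mul' _ _ (by finiteness)]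
  refine lintegral_congr fun x => ?_
  simp only [Pi.smul_apply, enorm_smul]
  ring

end IsH2

/-! ### The Dirichlet operator on one edge -/

/-- The graph of the Dirichlet operator: `u ∈ H²(0,1)`, `u(0) = u(1) = 0`, and
`v = -u'' + q u`. -/
def dirichletGraph (q : ℝ → ℝ) : Submodule ℂ (EdgeL2 × EdgeL2) where
  carrier := {w | ∃ U U' U'' : ℝ → ℂ, IsH2 U U' U'' ∧ w.1 =ᵐ[edgeMeasure] U ∧
    U 0 = 0 ∧ U 1 = 0 ∧ w.2 =ᵐ[edgeMeasure] fun x => -U'' x + q x * U x}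
  zero_mem' := by
    refine ⟨0, 0, 0, IsH2.zero, Lp.coeFn_zero .., rfl, rfl, ?_⟩
    refine (Lp.coeFn_zero ..).trans (.of_forall fun x => ?_)
    simp
  add_mem' := by
    rintro w₁ w₂ ⟨U, U', U'', h, h1, h2, h3, h4⟩ ⟨V, V', V'', k, k1, k2, k3, k4⟩
    refine ⟨U + V, U' + V', U'' + V'', h.add k, ?_, by simp [h2, k2], by simp [h3, k3], ?_⟩
    · exact (Lp.coeFn_add ..).trans (h1.add k1)
    · refine (Lp.coeFn_add ..).trans ((h4.add k4).trans (.of_forall fun x => ?_))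
      simp only [Pi.add_apply]
      ring
  smul_mem' := by
    rintro c w ⟨U, U', U'', h, h1, h2, h3, h4⟩
    refine ⟨c • U, c • U', c • U'', h.smul c, ?_, by simp [h2], by simp [h3], ?_⟩
    · exact (Lp.coeFn_smul ..).trans (h1.const_smul c)
    · refine (Lp.coeFn_smul ..).trans ((h4.const_smul c).trans (.of_forall fun x => ?_))
      simp only [Pi.smul_apply, smul_eq_mul]
      ring

lemma dirichletGraph_functional (q : ℝ → ℝ) (w : EdgeL2 × EdgeL2) (hw : w ∈ dirichletGraph q)
    (h0 : w.1 = 0) : w.2 = 0 := by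
  obtain ⟨U, U', U'', h, h1, -, -, h4⟩ := hw
  rw [h0] at h1
  have hU : U =ᵐ[edgeMeasure] 0 := h1.symm.trans (Lp.coeFn_zero ..)
  refine (Lp.eq_zero_iff_ae_eq_zero).2 ?_
  filter_upwards [h4, hU, h.ae_zero hU] with x a b c
  simp [a, b, c]

/-- The Dirichlet operator `-d²/dx² + q` in `L²(0,1)`. -/
def dirichletOperator (q : ℝ → ℝ) : EdgeL2 →ₗ.[ℂ] EdgeL2 := (dirichletGraph q).toLinearPMap

lemma dirichletOperator_graph (q : ℝ → ℝ) : (dirichletOperator q).graph = dirichletGraph q :=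
  Submodule.toLinearPMap_graph_eq _ (dirichletGraph_functional q)

/-! ### The hexagonal lattice -/

/-- Vertices of the hexagonal lattice: the translates `a p` and `b p` of the two vertices `a`, `b`
of the fundamental domain by `p₁ e₁ + p₂ e₂`, `p ∈ ℤ²`. In the plane, `e₁ = (3/2, √3/2)`,
`e₂ = (0, √3)`, `a = (0, 0)`, `b = (1/2, √3/2)`. -/
inductive Vertex : Type
  | a (p : ℤ × ℤ)
  | b (p : ℤ × ℤ)

/-- Edges of the hexagonal lattice: the edge `(p, t)` is the translate by `p₁ e₁ + p₂ e₂` of the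
edge `f` (`t = 0`), `g` (`t = 1`) or `h` (`t = 2`) of the fundamental domain. -/
abbrev Edge : Type := (ℤ × ℤ) × Fin 3

/-- `f`, `g`, `h` lead from `a` to `b`, `b - e₁`, `b - e₂`, respectively. -/
def shift : Fin 3 → ℤ × ℤ := ![(0, 0), (1, 0), (0, 1)]

/-- The end point of an edge at the coordinate `0`. -/
def Edge.source (e : Edge) : Vertex := .a e.1

/-- The end point of an edge at the coordinate `1`. -/
def Edge.target (e : Edge) : Vertex := .b (e.1 - shift e.2)

/-- The three edges at a vertex. -/
def Vertex.edge : Vertex → Fin 3 → Edge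
  | .a p, t => (p, t)
  | .b p, t => (p + shift t, t)

/-- The coordinate of a vertex on each of the edges at this vertex. -/
def Vertex.coord : Vertex → ℝ
  | .a _ => 0
  | .b _ => 1

/-- The sign that turns the derivative in the coordinate of an edge into the derivative in the
outgoing direction at the vertex. -/
def Vertex.sign : Vertex → ℂ
  | .a _ => 1
  | .b _ => -1

lemma incident_iff (e : Edge) (v : Vertex) :
    (Edge.source e = v ∨ Edge.target e = v) ↔ ∃ t, e = v.edge t := by
  obtain ⟨p, s⟩ := e
  cases v with
  | a r => simp [Edge.source, Edge.target, Vertex.edge]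
  | b r => simp [Edge.source, Edge.target, Vertex.edge, sub_eq_iff_eq_add]

/-! ### The graphene Hamiltonian -/

/-- `L²(G)`, the Hilbert sum of the spaces `L²(e)`. -/
abbrev GraphL2 : Type := lp (fun _ : Edge => EdgeL2) 2

/-- `u ∈ L²(G)` belongs to the domain of the Hamiltonian, where `U e`, `U' e`, `U'' e` are the
`C¹` representative of the restriction of `u` to the edge `e` and its derivatives: `u` is in `H²`
on each edge, the sum of the squares of the `H²`-norms is finite, and at each vertex `u` is
continuous and the sum of the outgoing derivatives vanishes. -/
structure InDomain (u : GraphL2) (U U' U'' : Edge → ℝ → ℂ) : Prop where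
  isH2 : ∀ e, IsH2 (U e) (U' e) (U'' e)
  ae_eq : ∀ e, u e =ᵐ[edgeMeasure] U e
  norm_finite : ∑' e, h2NormSq (U e) (U' e) (U'' e) < ∞
  continuity : ∀ (v : Vertex) (s t : Fin 3), U (v.edge s) v.coord = U (v.edge t) v.coord
  flux : ∀ v : Vertex, ∑ t, v.sign * U' (v.edge t) v.coord = 0

/-- The graph of the Hamiltonian: `u` is in the domain and `v = -u'' + q u` on each edge. -/
def hamiltonianGraph (q : ℝ → ℝ) : Submodule ℂ (GraphL2 × GraphL2) where
  carrier := {w | ∃ U U' U'' : Edge → ℝ → ℂ, InDomain w.1 U U' U'' ∧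
    ∀ e, w.2 e =ᵐ[edgeMeasure] fun x => -U'' e x + q x * U e x}
  zero_mem' := by
    refine ⟨0, 0, 0, ⟨fun _ => IsH2.zero, fun e => Lp.coeFn_zero .., ?_, ?_, ?_⟩, fun e => ?_⟩
    · simp [h2NormSq]
    · simp
    · simp
    · refine (Lp.coeFn_zero ..).trans (.of_forall fun x => ?_)
      simp
  add_mem' := by
    rintro w₁ w₂ ⟨U, U', U'', h, h4⟩ ⟨V, V', V'', k, k4⟩
    refine ⟨U + V, U' + V', U'' + V'', ⟨fun e => (h.isH2 e).add (k.isH2 e), fun e => ?_, ?_,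
      fun v s t => ?_, fun v => ?_⟩, fun e => ?_⟩
    · exact (Lp.coeFn_add (w₁.1 e) (w₂.1 e)).trans ((h.ae_eq e).add (k.ae_eq e))
    · refine lt_of_le_of_lt (ENNReal.tsum_le_tsum fun e => (h.isH2 e).h2NormSq_add_le) ?_
      rw [ENNReal.tsum_add, ENNReal.tsum_mul_left, ENNReal.tsum_mul_left]
      have := h.norm_finite
      have := k.norm_finite
      finiteness
    · simp only [Pi.add_apply]
      rw [h.continuity v s t, k.continuity v s t]
    · simp only [Pi.add_apply, mul_add, Finset.sum_add_distrib]
      rw [h.flux v, k.flux v, add_zero]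
    · refine (Lp.coeFn_add (w₁.2 e) (w₂.2 e)).trans
        (((h4 e).add (k4 e)).trans (.of_forall fun x => ?_))
      simp only [Pi.add_apply]
      ring
  smul_mem' := by
    rintro c w ⟨U, U', U'', h, h4⟩
    refine ⟨c • U, c • U', c • U'', ⟨fun e => (h.isH2 e).smul c, fun e => ?_, ?_,
      fun v s t => ?_, fun v => ?_⟩, fun e => ?_⟩
    · exact (Lp.coeFn_smul c (w.1 e)).trans ((h.ae_eq e).const_smul c)
    · simp only [Pi.smul_apply, IsH2.h2NormSq_smul, ENNReal.tsum_mul_left]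
      have := h.norm_finite
      finiteness
    · simp only [Pi.smul_apply]
      rw [h.continuity v s t]
    · simp only [Pi.smul_apply, mul_smul_comm, ← Finset.smul_sum]
      rw [h.flux v, smul_zero]
    · refine (Lp.coeFn_smul c (w.2 e)).trans (((h4 e).const_smul c).trans (.of_forall fun x => ?_))
      simp only [Pi.smul_apply, smul_eq_mul]
      ring

lemma hamiltonianGraph_functional (q : ℝ → ℝ) (w : GraphL2 × GraphL2)
    (hw : w ∈ hamiltonianGraph q) (h0 : w.1 = 0) : w.2 = 0 := by
  obtain ⟨U, U', U'', h, h4⟩ := hw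
  ext1
  funext e
  have h1 := h.ae_eq e
  rw [h0] at h1
  have hU : U e =ᵐ[edgeMeasure] 0 := h1.symm.trans (Lp.coeFn_zero ..)
  refine (Lp.eq_zero_iff_ae_eq_zero).2 ?_
  filter_upwards [h4 e, hU, (h.isH2 e).ae_zero hU] with x a b c
  simp [a, b, c]

/-- The graphene Hamiltonian `-d²/dx² + q` in `L²(G)`. -/
def hamiltonian (q : ℝ → ℝ) : GraphL2 →ₗ.[ℂ] GraphL2 := (hamiltonianGraph q).toLinearPMap

lemma hamiltonian_graph (q : ℝ → ℝ) : (hamiltonian q).graph = hamiltonianGraph q :=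
  Submodule.toLinearPMap_graph_eq _ (hamiltonianGraph_functional q)

/-! ### Since `q u ∈ L²` for `q ∈ L²` and `u ∈ H²`, the domains are the intended ones -/

lemma lintegral_enorm_sq_eq (f : ℝ → ℂ) :
    ∫⁻ x, ‖f x‖ₑ ^ 2 ∂edgeMeasure = eLpNorm f 2 edgeMeasure ^ 2 := by
  rw [eLpNorm_eq_lintegral_rpow_enorm_toReal (by norm_num) (by norm_num), ← ENNReal.rpow_natCast,
    ← ENNReal.rpow_mul]
  simp

instance : IsProbabilityMeasure edgeMeasure := ⟨by simp⟩

lemma IsH2.sup_le {u u' u'' : ℝ → ℂ} (h : IsH2 u u' u'') {x : ℝ} (hx : x ∈ Icc (0 : ℝ) 1) :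
    ‖u x‖ₑ ^ 2 ≤ 2 * h2NormSq u u' u'' := by
  set D : ℝ≥0∞ := ∫⁻ t, ‖u' t‖ₑ ^ 2 ∂edgeMeasure with hD
  have key : ∀ y ∈ Icc (0 : ℝ) 1, ‖u x‖ₑ ^ 2 ≤ 2 * ‖u y‖ₑ ^ 2 + 2 * D := by
    intro y hy
    have e : u x = u y + ∫ t in y..x, u' t := by
      rw [h.eq x hx, h.eq y hy, add_assoc, intervalIntegral.integral_add_adjacent_intervals
        (intervalIntegrable_of_memLp h.memLp_deriv hy)
        ((intervalIntegrable_of_memLp h.memLp_deriv hy).symm.trans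
          (intervalIntegrable_of_memLp h.memLp_deriv hx))]
    have b : ‖∫ t in y..x, u' t‖ₑ ≤ eLpNorm u' 2 edgeMeasure := by
      calc ‖∫ t in y..x, u' t‖ₑ = ‖∫ t in uIoc y x, u' t‖ₑ := by
            rw [← ofReal_norm, ← ofReal_norm, intervalIntegral.norm_intervalIntegral_eq]
        _ ≤ ∫⁻ t in uIoc y x, ‖u' t‖ₑ := enorm_integral_le_lintegral_enorm _
        _ ≤ ∫⁻ t in Icc (0 : ℝ) 1, ‖u' t‖ₑ := by
            refine lintegral_mono_set (uIoc_subset_uIcc.trans ?_)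
            exact ordConnected_Icc.uIcc_subset hy hx
        _ = eLpNorm u' 1 edgeMeasure := by rw [eLpNorm_one_eq_lintegral_enorm]
        _ ≤ _ := eLpNorm_le_eLpNorm_of_exponent_le (by norm_num)
            h.memLp_deriv.aestronglyMeasurable
    calc ‖u x‖ₑ ^ 2 ≤ 2 * ‖u y‖ₑ ^ 2 + 2 * ‖∫ t in y..x, u' t‖ₑ ^ 2 := by
          rw [e]; exact enorm_add_sq_le _ _
      _ ≤ _ := by rw [hD, lintegral_enorm_sq_eq]; gcongr
  have m := h.memLp_self.aestronglyMeasurable.enorm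
  have m' := h.memLp_deriv.aestronglyMeasurable.enorm
  calc ‖u x‖ₑ ^ 2 = ∫⁻ _, ‖u x‖ₑ ^ 2 ∂edgeMeasure := by simp
    _ ≤ ∫⁻ y, (2 * ‖u y‖ₑ ^ 2 + 2 * D) ∂edgeMeasure :=
        lintegral_mono_ae ((ae_restrict_iff' measurableSet_Icc).2 (.of_forall key))
    _ = 2 * ∫⁻ y, (‖u y‖ₑ ^ 2 + ‖u' y‖ₑ ^ 2) ∂edgeMeasure := by
        rw [lintegral_add_right _ measurable_const, lintegral_const_mul' _ _ (by norm_num),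
          lintegral_add_left' (by fun_prop), mul_add]
        simp [hD]
    _ ≤ _ := by
        exact mul_le_mul' le_rfl (lintegral_mono fun y => le_self_add)

lemma IsH2.operator_le {q : ℝ → ℝ} {u u' u'' : ℝ → ℂ} (h : IsH2 u u' u'') :
    ∫⁻ x, ‖-u'' x + q x * u x‖ₑ ^ 2 ∂edgeMeasure ≤
      (2 + 4 * ∫⁻ x, ‖q x‖ₑ ^ 2 ∂edgeMeasure) * h2NormSq u u' u'' := by
  set N := h2NormSq u u' u'' with hN
  have m := h.memLp.aestronglyMeasurable.enorm
  have m1 : ∫⁻ x, ‖u'' x‖ₑ ^ 2 ∂edgeMeasure ≤ N := by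
    rw [hN]
    unfold h2NormSq
    gcongr
    exact le_add_self
  by_cases hNt : N = ∞
  · rw [hNt, ENNReal.mul_top (by simp)]
    exact le_top
  calc ∫⁻ x, ‖-u'' x + q x * u x‖ₑ ^ 2 ∂edgeMeasure
      ≤ ∫⁻ x, (2 * ‖u'' x‖ₑ ^ 2 + 4 * N * ‖q x‖ₑ ^ 2) ∂edgeMeasure := by
        refine lintegral_mono_ae ((ae_restrict_iff' measurableSet_Icc).2 (.of_forall ?_))
        intro x hx
        refine (enorm_add_sq_le _ _).trans ?_
        rw [enorm_neg, enorm_mul, mul_pow]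
        refine add_le_add le_rfl ?_
        calc 2 * (‖(q x : ℂ)‖ₑ ^ 2 * ‖u x‖ₑ ^ 2) ≤ 2 * (‖(q x : ℂ)‖ₑ ^ 2 * (2 * N)) := by
              gcongr
              exact h.sup_le hx
          _ = 4 * N * ‖q x‖ₑ ^ 2 := by
              have : ‖(q x : ℂ)‖ₑ = ‖q x‖ₑ := by
                rw [← ofReal_norm, ← ofReal_norm, Complex.norm_real]
              rw [this]
              ring
    _ = 2 * ∫⁻ x, ‖u'' x‖ₑ ^ 2 ∂edgeMeasure + 4 * N * ∫⁻ x, ‖q x‖ₑ ^ 2 ∂edgeMeasure := by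
        rw [lintegral_add_left' (by fun_prop), lintegral_const_mul' _ _ (by norm_num),
          lintegral_const_mul' _ _ (by finiteness)]
    _ ≤ 2 * N + 4 * N * ∫⁻ x, ‖q x‖ₑ ^ 2 ∂edgeMeasure := by gcongr
    _ = _ := by ring

lemma potential_sq_lt_top {q : ℝ → ℝ} (hq : MemLp q 2 edgeMeasure) :
    ∫⁻ x, ‖q x‖ₑ ^ 2 ∂edgeMeasure < ∞ := by
  have := hq.eLpNorm_lt_top
  rw [eLpNorm_lt_top_iff_lintegral_rpow_enorm_lt_top (by norm_num) (by norm_num)] at this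
  simpa using this

lemma IsH2.norm_lt_top {u u' u'' : ℝ → ℂ} (h : IsH2 u u' u'') : h2NormSq u u' u'' < ∞ := by
  have m := h.memLp_self.aestronglyMeasurable.enorm
  have m' := h.memLp_deriv.aestronglyMeasurable.enorm
  unfold h2NormSq
  rw [lintegral_add_left' (by fun_prop), lintegral_add_left' (by fun_prop)]
  simp only [lintegral_enorm_sq_eq]
  have := h.memLp_self.eLpNorm_lt_top
  have := h.memLp_deriv.eLpNorm_lt_top
  have := h.memLp.eLpNorm_lt_top
  finiteness

lemma IsH2.operator_memLp {q : ℝ → ℝ} (hq : MemLp q 2 edgeMeasure) {u u' u'' : ℝ → ℂ}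
    (h : IsH2 u u' u'') : MemLp (fun x => -u'' x + q x * u x) 2 edgeMeasure := by
  refine ⟨h.memLp.aestronglyMeasurable.neg.add
    ((Complex.continuous_ofReal.comp_aestronglyMeasurable hq.aestronglyMeasurable).mul
      h.memLp_self.aestronglyMeasurable), ?_⟩
  have h1 : ∫⁻ x, ‖-u'' x + q x * u x‖ₑ ^ 2 ∂edgeMeasure < ∞ := by
    refine lt_of_le_of_lt h.operator_le ?_
    have := potential_sq_lt_top hq
    have := h.norm_lt_top
    finiteness
  rw [lintegral_enorm_sq_eq] at h1
  exact (ENNReal.pow_lt_top_iff.1 h1).resolve_right (by norm_num)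

/-- The domain of the Dirichlet operator is `{u ∈ H²(0,1) | u(0) = u(1) = 0}`. -/
lemma mem_dirichletOperator_domain {q : ℝ → ℝ} (hq : MemLp q 2 edgeMeasure) (u : EdgeL2) :
    u ∈ (dirichletOperator q).domain ↔
      ∃ U U' U'' : ℝ → ℂ, IsH2 U U' U'' ∧ u =ᵐ[edgeMeasure] U ∧ U 0 = 0 ∧ U 1 = 0 := by
  constructor
  · rintro ⟨w, ⟨U, U', U'', h, h1, h2, h3, -⟩, rfl⟩
    exact ⟨U, U', U'', h, h1, h2, h3⟩
  · rintro ⟨U, U', U'', h, h1, h2, h3⟩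
    exact ⟨(u, (h.operator_memLp hq).toLp _),
      ⟨U, U', U'', h, h1, h2, h3, (h.operator_memLp hq).coeFn_toLp⟩, rfl⟩

/-- The domain of the Hamiltonian consists of all functions described by `InDomain`. -/
lemma mem_hamiltonian_domain {q : ℝ → ℝ} (hq : MemLp q 2 edgeMeasure) (u : GraphL2) :
    u ∈ (hamiltonian q).domain ↔ ∃ U U' U'' : Edge → ℝ → ℂ, InDomain u U U' U'' := by
  constructor
  · rintro ⟨w, ⟨U, U', U'', h, -⟩, rfl⟩
    exact ⟨U, U', U'', h⟩
  · rintro ⟨U, U', U'', h⟩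
    have hv : Memℓp (fun e : Edge => ((h.isH2 e).operator_memLp hq).toLp _) 2 := by
      refine memℓp_gen ?_
      have hs : ∑' e, eLpNorm (fun x => -U'' e x + q x * U e x) 2 edgeMeasure ^ 2 ≠ ∞ := by
        refine (lt_of_le_of_lt (ENNReal.tsum_le_tsum fun e => ?_) (?_ : ∑' e,
          (2 + 4 * ∫⁻ x, ‖q x‖ₑ ^ 2 ∂edgeMeasure) * h2NormSq (U e) (U' e) (U'' e) < ∞)).ne
        · rw [← lintegral_enorm_sq_eq]
          exact (h.isH2 e).operator_le
        · rw [ENNReal.tsum_mul_left]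
          have := potential_sq_lt_top hq
          have := h.norm_finite
          finiteness
      refine (ENNReal.summable_toReal hs).congr fun e => ?_
      simp [Lp.norm_toLp, ENNReal.toReal_pow]
    exact ⟨(u, ⟨_, hv⟩), ⟨U, U', U'', h, fun e => ((h.isH2 e).operator_memLp hq).coeFn_toLp⟩, rfl⟩

/-! ### Solutions of the differential equation on one edge -/

/-- `φ`, with derivative `φ'`, solves `-φ'' + q φ = z φ` on `[0,1]`. -/
def IsSolution (q : ℝ → ℝ) (z : ℂ) (φ φ' : ℝ → ℂ) : Prop :=
  ∃ φ'' : ℝ → ℂ, IsH2 φ φ' φ'' ∧ ∀ᵐ x ∂edgeMeasure, -φ'' x + q x * φ x = z * φ x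

/-- `M` is the monodromy matrix of the equation `-φ'' + q φ = z φ` over the period `[0,1]`. -/
def IsMonodromy (q : ℝ → ℝ) (z : ℂ) (M : Matrix (Fin 2) (Fin 2) ℂ) : Prop :=
  ∀ φ φ' : ℝ → ℂ, IsSolution q z φ φ' → ![φ 1, φ' 1] = M.mulVec ![φ 0, φ' 0]

end Graphene

end

noncomputable section

namespace Graphene

/-! ### Functions of class `H²` on one edge -/

/-! Write `κ = φ'(0)`, `η = φ'(1)/κ` and let `A` be the adjacency operator on `ℓ²` of the vertices.
Outside the Dirichlet spectrum a solution on an edge is determined by its end values, and since the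
potential is even, `φ(1 - x)` solves the equation along with `φ(x)`. Hence every solution is `χ(0)
φ(1 - x) + χ(1) φ(x)` (`IsSolution.eq_combination`). Applied to the derivatives at both ends, this
determines the monodromy matrix; both its diagonal entries are `η`, so its trace is `2η`
(`isMonodromy_iff`).

On the graph, gluing such solutions with vertex values `f` gives outgoing derivatives at `y` with
sum `κ ((A f)(y) - 3 η f(y))`. The vertex conditions thus turn `H - z` into `A - 3η`, and the proof
compares the two operators directly, without a Floquet decomposition.

If `3η` is not in the spectrum of `A`, then `(H - z) u = v` is solved by a Dirichlet solution on
each edge plus a glued solution whose vertex values cancel the flux defect; this inverts `H - z`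
boundedly (`mem_resolventSet_hamiltonian`). So `z` in the spectrum of `H` forces `3η` into the
spectrum of `A`, which lies in `[-3, 3]` because `A` is self-adjoint with norm at most `3`. Each
square of a number in this interval is a value of `|1 + e^{iθ₁} + e^{iθ₂}|²` (`exists_dispersion`).

Conversely, a bounded inverse of `H - z` yields `‖f‖² ≤ C ‖(A - 3η) f‖²` on `ℓ²`
(`exists_vertex_estimate`). If `9η² = |1 + e^{iθ₁} + e^{iθ₂}|²`, exponentially damped plane waves
violate every such estimate (`exists_approximate_eigenfunction`). The second form of the dispersion
relation is a trigonometric identity (`norm_sq_dispersion`). -/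

lemma sub_eq_integral_of_primitive {f g : ℝ → ℂ} (hg : MemLp g 2 edgeMeasure)
    (h : ∀ x ∈ Icc (0 : ℝ) 1, f x = f 0 + ∫ t in (0 : ℝ)..x, g t) {x y : ℝ}
    (hx : x ∈ Icc (0 : ℝ) 1) (hy : y ∈ Icc (0 : ℝ) 1) : f y - f x = ∫ t in x..y, g t := by
  rw [h x hx, h y hy, add_sub_add_left_eq_sub, intervalIntegral.integral_interval_sub_left
    (intervalIntegrable_of_memLp hg hy) (intervalIntegrable_of_memLp hg hx)]

lemma enorm_intervalIntegral_le_eLpNorm (g : ℝ → ℂ) {x y : ℝ}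
    (hx : x ∈ Icc (0 : ℝ) 1) (hy : y ∈ Icc (0 : ℝ) 1) :
    ‖∫ t in x..y, g t‖ₑ ≤ eLpNorm g 1 edgeMeasure := by
  calc ‖∫ t in x..y, g t‖ₑ = ‖∫ t in uIoc x y, g t‖ₑ := by
        rw [← ofReal_norm, ← ofReal_norm, intervalIntegral.norm_intervalIntegral_eq]
    _ ≤ ∫⁻ t in uIoc x y, ‖g t‖ₑ := enorm_integral_le_lintegral_enorm _
    _ ≤ ∫⁻ t in Icc (0 : ℝ) 1, ‖g t‖ₑ :=
        lintegral_mono_set (uIoc_subset_uIcc.trans (ordConnected_Icc.uIcc_subset hx hy))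
    _ = eLpNorm g 1 edgeMeasure := by rw [eLpNorm_one_eq_lintegral_enorm]

lemma measurePreserving_one_sub :
    MeasurePreserving (fun x : ℝ => 1 - x) edgeMeasure edgeMeasure := by
  have h := (Measure.measurePreserving_sub_left volume (1 : ℝ)).restrict_preimage
    (measurableSet_Icc (a := (0 : ℝ)) (b := 1))
  have e : (fun x : ℝ => 1 - x) ⁻¹' Icc 0 1 = Icc 0 1 := by simp
  rwa [e] at h

lemma lintegral_enorm_sq_le_of_bound {f : ℝ → ℂ} {C : ℝ≥0∞}
    (h : ∀ x ∈ Icc (0 : ℝ) 1, ‖f x‖ₑ ≤ C) : ∫⁻ x, ‖f x‖ₑ ^ 2 ∂edgeMeasure ≤ C ^ 2 := by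
  calc ∫⁻ x, ‖f x‖ₑ ^ 2 ∂edgeMeasure ≤ ∫⁻ _, C ^ 2 ∂edgeMeasure :=
        lintegral_mono_ae ((ae_restrict_iff' measurableSet_Icc).2
          (.of_forall fun x hx => by gcongr; exact h x hx))
    _ = C ^ 2 := by simp

namespace IsH2

variable {u u' u'' : ℝ → ℂ}

lemma of_hasDerivAt (h : ∀ x, HasDerivAt u (u' x) x) (h' : ∀ x, HasDerivAt u' (u'' x) x)
    (hc : Continuous u'') : IsH2 u u' u'' where
  memLp := memLp_of_continuousOn hc.continuousOn
  deriv_eq x _ := by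
    rw [intervalIntegral.integral_eq_sub_of_hasDerivAt (fun y _ => h' y)
      (hc.intervalIntegrable _ _)]
    ring
  eq x _ := by
    have : Continuous u' := continuous_iff_continuousAt.2 fun y => (h' y).continuousAt
    rw [intervalIntegral.integral_eq_sub_of_hasDerivAt (fun y _ => h y)
      (this.intervalIntegrable _ _)]
    ring

lemma comp_one_sub (h : IsH2 u u' u'') :
    IsH2 (fun x => u (1 - x)) (fun x => -u' (1 - x)) (fun x => u'' (1 - x)) where
  memLp := h.memLp.comp_measurePreserving measurePreserving_one_sub
  deriv_eq x hx := by
    have hx' : 1 - x ∈ Icc (0 : ℝ) 1 := ⟨by linarith [hx.2], by linarith [hx.1]⟩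
    rw [intervalIntegral.integral_comp_sub_left (fun t => u'' t), sub_zero,
      ← sub_eq_integral_of_primitive h.memLp h.deriv_eq hx' (right_mem_Icc.2 zero_le_one)]
    ring
  eq x hx := by
    have hx' : 1 - x ∈ Icc (0 : ℝ) 1 := ⟨by linarith [hx.2], by linarith [hx.1]⟩
    rw [intervalIntegral.integral_neg, intervalIntegral.integral_comp_sub_left (fun t => u' t),
      sub_zero,
      ← sub_eq_integral_of_primitive h.memLp_deriv h.eq hx' (right_mem_Icc.2 zero_le_one)]
    ring

lemma eqOn_zero (h : IsH2 u u' u'') (h0 : u =ᵐ[edgeMeasure] 0) : EqOn u 0 (Icc 0 1) :=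
  Measure.eqOn_Icc_of_ae_eq volume (by norm_num) h0 h.continuousOn continuousOn_const

lemma deriv_eqOn_zero (h : IsH2 u u' u'') (h0 : EqOn u 0 (Icc 0 1)) :
    EqOn u' 0 (Icc 0 1) := by
  refine Measure.eqOn_Icc_of_ae_eq volume (by norm_num) ?_ h.continuousOn_deriv continuousOn_const
  refine ae_eq_zero_of_primitive h.memLp_deriv fun x hx => ?_
  have := h.eq x hx
  rw [h0 hx, h0 (left_mem_Icc.2 zero_le_one)] at this
  simpa using this.symm

/-- A function that takes the same value at both end points has a derivative of mean zero, which is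
therefore bounded by the total variation of the derivative. -/
lemma deriv_le_of_eq_ends (h : IsH2 u u' u'') (h01 : u 0 = u 1) {x : ℝ}
    (hx : x ∈ Icc (0 : ℝ) 1) : ‖u' x‖ₑ ≤ eLpNorm u'' 1 edgeMeasure := by
  have hi : ∫ t in (0 : ℝ)..1, u' t = 0 := by
    rw [← sub_eq_integral_of_primitive h.memLp_deriv h.eq (left_mem_Icc.2 zero_le_one)
      (right_mem_Icc.2 zero_le_one), h01, sub_self]
  have e : u' x = ∫ t in (0 : ℝ)..1, (u' x - u' t) := by
    rw [intervalIntegral.integral_sub (by simp)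
      (intervalIntegrable_of_memLp h.memLp_deriv (right_mem_Icc.2 zero_le_one)), hi]
    simp
  rw [e]
  refine (enorm_intervalIntegral_le_eLpNorm _ (left_mem_Icc.2 zero_le_one)
    (right_mem_Icc.2 zero_le_one)).trans ?_
  rw [eLpNorm_one_eq_lintegral_enorm]
  calc ∫⁻ t, ‖u' x - u' t‖ₑ ∂edgeMeasure ≤ ∫⁻ _, eLpNorm u'' 1 edgeMeasure ∂edgeMeasure := by
        refine lintegral_mono_ae ((ae_restrict_iff' measurableSet_Icc).2 (.of_forall ?_))
        intro t ht
        rw [sub_eq_integral_of_primitive h.memLp h.deriv_eq ht hx]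
        exact enorm_intervalIntegral_le_eLpNorm _ ht hx
    _ = eLpNorm u'' 1 edgeMeasure := by simp

lemma le_of_zero_ends (h : IsH2 u u' u'') (h0 : u 0 = 0) (h1 : u 1 = 0) {x : ℝ}
    (hx : x ∈ Icc (0 : ℝ) 1) : ‖u x‖ₑ ≤ eLpNorm u'' 1 edgeMeasure := by
  rw [h.eq x hx, h0, zero_add]
  refine (enorm_intervalIntegral_le_eLpNorm _ (left_mem_Icc.2 zero_le_one) hx).trans ?_
  rw [eLpNorm_one_eq_lintegral_enorm]
  calc ∫⁻ t, ‖u' t‖ₑ ∂edgeMeasure ≤ ∫⁻ _, eLpNorm u'' 1 edgeMeasure ∂edgeMeasure :=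
        lintegral_mono_ae ((ae_restrict_iff' measurableSet_Icc).2
          (.of_forall fun t ht => h.deriv_le_of_eq_ends (h0.trans h1.symm) ht))
    _ = eLpNorm u'' 1 edgeMeasure := by simp

lemma h2NormSq_eq (h : IsH2 u u' u'') : h2NormSq u u' u'' =
    ∫⁻ x, ‖u x‖ₑ ^ 2 ∂edgeMeasure + ∫⁻ x, ‖u' x‖ₑ ^ 2 ∂edgeMeasure
      + ∫⁻ x, ‖u'' x‖ₑ ^ 2 ∂edgeMeasure := by
  have m := h.memLp_self.aestronglyMeasurable.enorm
  have m' := h.memLp_deriv.aestronglyMeasurable.enorm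
  unfold h2NormSq
  rw [lintegral_add_left' (by fun_prop), lintegral_add_left' (by fun_prop)]

end IsH2

/-! ### Consequences of the invertibility of the Dirichlet operator -/

lemma memLp_potential_sub {q : ℝ → ℝ} (hq : MemLp q 2 edgeMeasure) (z : ℂ) :
    MemLp (fun x => (q x : ℂ) - z) 2 edgeMeasure :=
  hq.ofReal.sub (memLp_const z)

/-- The a priori estimate for the Dirichlet problem: the `H²`-norm and the derivatives at the end
points are controlled by the `L²`-norms of the function and of the right-hand side. -/
lemma dirichlet_estimate {q : ℝ → ℝ} (hq : MemLp q 2 edgeMeasure) (z : ℂ) {K : ℝ≥0∞}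
    (hK : K ≠ ∞) : ∃ C : ℝ≥0∞, C ≠ ∞ ∧ ∀ (v : EdgeL2) (W W' W'' : ℝ → ℂ), IsH2 W W' W'' →
      W 0 = 0 → W 1 = 0 → (v =ᵐ[edgeMeasure] fun x => -W'' x + q x * W x - z * W x) →
      eLpNorm W 2 edgeMeasure ≤ K * ‖v‖ₑ →
      h2NormSq W W' W'' ≤ C * ‖v‖ₑ ^ 2 ∧ ‖W' 0‖ₑ ^ 2 ≤ C * ‖v‖ₑ ^ 2 ∧
        ‖W' 1‖ₑ ^ 2 ≤ C * ‖v‖ₑ ^ 2 := by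
  have hp := memLp_potential_sub hq z
  set p : ℝ → ℂ := fun x => (q x : ℂ) - z with hp_def
  set Q := eLpNorm p 2 edgeMeasure with hQ
  have hQt : Q ≠ ∞ := hp.eLpNorm_ne_top
  set B := Q * K + 1 with hB
  -- Here `2 * B ^ 2` accounts for `W` and `W'`, each bounded uniformly by `B * ‖v‖ₑ`, and the
  -- remaining summand accounts for `W''`.
  refine ⟨2 * B ^ 2 + (2 * Q ^ 2 * B ^ 2 + 2), by finiteness, ?_⟩
  intro v W W' W'' h h0 h1 hv hW
  set L := eLpNorm W'' 1 edgeMeasure with hL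
  have hvn : eLpNorm v 2 edgeMeasure = ‖v‖ₑ := (Lp.enorm_def v).symm
  have hW'' : W'' =ᵐ[edgeMeasure] p • W - ⇑v := by
    filter_upwards [hv] with x hx
    simp only [Pi.sub_apply, smul_eq_mul, Pi.mul_apply, hx, hp_def]
    ring
  -- The potential is only in `L²`, so an `L²` bound on `W` controls `W'' = p W - v` merely in `L¹`.
  -- With zero end values this already bounds `W` and `W'` uniformly, after which `p W` can be
  -- estimated in `L²`.
  have hLB : L ≤ B * ‖v‖ₑ := by
    calc L = eLpNorm (p • W - ⇑v) 1 edgeMeasure := eLpNorm_congr_ae hW''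
      _ ≤ eLpNorm (p • W) 1 edgeMeasure + eLpNorm v 1 edgeMeasure :=
          eLpNorm_sub_le (hp.aestronglyMeasurable.smul h.memLp_self.aestronglyMeasurable)
            (Lp.aestronglyMeasurable v) le_rfl
      _ ≤ Q * eLpNorm W 2 edgeMeasure + eLpNorm v 2 edgeMeasure := by
          refine add_le_add ?_ (eLpNorm_le_eLpNorm_of_exponent_le (by norm_num)
            (Lp.aestronglyMeasurable v))
          exact eLpNorm_smul_le_mul_eLpNorm h.memLp_self.aestronglyMeasurable
            hp.aestronglyMeasurable
      _ ≤ Q * (K * ‖v‖ₑ) + ‖v‖ₑ := by rw [hvn]; gcongr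
      _ = B * ‖v‖ₑ := by rw [hB]; ring
  have hs : ∀ x ∈ Icc (0 : ℝ) 1, ‖W x‖ₑ ≤ B * ‖v‖ₑ := fun x hx =>
    (h.le_of_zero_ends h0 h1 hx).trans hLB
  have hs' : ∀ x ∈ Icc (0 : ℝ) 1, ‖W' x‖ₑ ≤ B * ‖v‖ₑ := fun x hx =>
    (h.deriv_le_of_eq_ends (h0.trans h1.symm) hx).trans hLB
  have hd : ∀ x ∈ Icc (0 : ℝ) 1,
      ‖W' x‖ₑ ^ 2 ≤ (2 * B ^ 2 + (2 * Q ^ 2 * B ^ 2 + 2)) * ‖v‖ₑ ^ 2 := by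
    intro x hx
    calc ‖W' x‖ₑ ^ 2 ≤ (B * ‖v‖ₑ) ^ 2 := by gcongr; exact hs' x hx
      _ = B ^ 2 * ‖v‖ₑ ^ 2 := by ring
      _ ≤ _ := by
          gcongr
          calc B ^ 2 = 1 * B ^ 2 := by ring
            _ ≤ 2 * B ^ 2 := by gcongr; norm_num
            _ ≤ _ := le_self_add
  refine ⟨?_, hd 0 (left_mem_Icc.2 zero_le_one), hd 1 (right_mem_Icc.2 zero_le_one)⟩
  have h2 : ∫⁻ x, ‖W'' x‖ₑ ^ 2 ∂edgeMeasure ≤ (2 * Q ^ 2 * B ^ 2 + 2) * ‖v‖ₑ ^ 2 := by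
    have mp := hp.aestronglyMeasurable.enorm
    have hae : ∀ᵐ x ∂edgeMeasure,
        ‖W'' x‖ₑ ^ 2 ≤ 2 * (B * ‖v‖ₑ) ^ 2 * ‖p x‖ₑ ^ 2 + 2 * ‖v x‖ₑ ^ 2 := by
      filter_upwards [hW'', ae_restrict_mem measurableSet_Icc] with x hx hxm
      rw [hx]
      simp only [Pi.sub_apply, smul_eq_mul, Pi.mul_apply, sub_eq_add_neg]
      refine (enorm_add_sq_le _ _).trans ?_
      rw [enorm_neg, enorm_mul]
      refine add_le_add ?_ le_rfl
      calc 2 * (‖p x‖ₑ * ‖W x‖ₑ) ^ 2 ≤ 2 * (‖p x‖ₑ * (B * ‖v‖ₑ)) ^ 2 := by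
            gcongr; exact hs x hxm
        _ = _ := by ring
    refine (lintegral_mono_ae hae).trans ?_
    rw [lintegral_add_left' (by fun_prop), lintegral_const_mul' _ _ (by finiteness),
      lintegral_const_mul' _ _ (by finiteness), lintegral_enorm_sq_eq, lintegral_enorm_sq_eq,
      hvn]
    exact le_of_eq (by ring)
  rw [h.h2NormSq_eq]
  calc _ ≤ (B * ‖v‖ₑ) ^ 2 + (B * ‖v‖ₑ) ^ 2 + (2 * Q ^ 2 * B ^ 2 + 2) * ‖v‖ₑ ^ 2 :=
        add_le_add (add_le_add (lintegral_enorm_sq_le_of_bound hs)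
          (lintegral_enorm_sq_le_of_bound hs')) h2
    _ = _ := by ring

/-- Membership in the resolvent set of an operator with a prescribed graph. -/
lemma mem_resolventSet_iff_graph {X : Type*} [NormedAddCommGroup X] [NormedSpace ℂ X]
    {T : X →ₗ.[ℂ] X} {G : Submodule ℂ (X × X)} (hT : T.graph = G) {z : ℂ} :
    z ∈ resolventSet T ↔ ∃ R : X →L[ℂ] X,
      (∀ v : X, (R v, v + z • R v) ∈ G) ∧ ∀ w ∈ G, R (w.2 - z • w.1) = w.1 := by
  subst hT
  refine exists_congr fun R => and_congr (forall_congr' fun v => ?_) ?_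
  · rw [LinearPMap.mem_graph_iff]
    constructor
    · rintro ⟨h, e⟩
      exact ⟨⟨R v, h⟩, rfl, sub_eq_iff_eq_add.1 e⟩
    · rintro ⟨⟨y, hy⟩, e1, e2⟩
      simp only at e1 e2
      subst e1
      exact ⟨hy, by rw [e2]; simp⟩
  · constructor
    · rintro h ⟨w1, w2⟩ hw
      obtain ⟨y, e1, e2⟩ := (LinearPMap.mem_graph_iff T).1 hw
      simp only at e1 e2
      rw [← e1, ← e2]
      exact h y
    · intro h u
      exact h (u, T u) (T.mem_graph u)

/-- The constant does not depend on the right-hand side. The lemma can therefore be applied on all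
edges simultaneously while keeping square summability, of the solutions as well as of their end
derivatives. -/
lemma exists_dirichlet_solution {q : ℝ → ℝ} (hq : MemLp q 2 edgeMeasure) {z : ℂ}
    (hz : z ∉ spectrum (dirichletOperator q)) : ∃ C : ℝ≥0∞, C ≠ ∞ ∧ ∀ v : EdgeL2,
      ∃ W W' W'' : ℝ → ℂ, IsH2 W W' W'' ∧ W 0 = 0 ∧ W 1 = 0 ∧
        (v =ᵐ[edgeMeasure] fun x => -W'' x + q x * W x - z * W x) ∧
        h2NormSq W W' W'' ≤ C * ‖v‖ₑ ^ 2 ∧ ‖W' 0‖ₑ ^ 2 ≤ C * ‖v‖ₑ ^ 2 ∧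
        ‖W' 1‖ₑ ^ 2 ≤ C * ‖v‖ₑ ^ 2 := by
  obtain ⟨R, hR, -⟩ := (mem_resolventSet_iff_graph (dirichletOperator_graph q)).1
    (not_not.1 hz)
  obtain ⟨C, hC, hest⟩ := dirichlet_estimate hq z (K := ‖R‖ₑ) (by finiteness)
  refine ⟨C, hC, fun v => ?_⟩
  obtain ⟨W, W', W'', h, h1, h2, h3, h4⟩ := hR v
  have hv : v =ᵐ[edgeMeasure] fun x => -W'' x + q x * W x - z * W x := by
    filter_upwards [h1, h4, Lp.coeFn_add v (z • R v), Lp.coeFn_smul z (R v)] with x a b c d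
    rw [← b, ← a]
    simp only [c, d, Pi.add_apply, Pi.smul_apply, smul_eq_mul]
    ring
  refine ⟨W, W', W'', h, h2, h3, hv, hest v W W' W'' h h2 h3 hv ?_⟩
  rw [← eLpNorm_congr_ae h1, ← Lp.enorm_def]
  exact R.le_opENorm v

/-! ### Solutions of the differential equation -/

lemma IsSolution.add {q : ℝ → ℝ} {z : ℂ} {φ φ' ψ ψ' : ℝ → ℂ} (h : IsSolution q z φ φ')
    (k : IsSolution q z ψ ψ') : IsSolution q z (φ + ψ) (φ' + ψ') := by
  obtain ⟨φ'', h1, h2⟩ := h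
  obtain ⟨ψ'', k1, k2⟩ := k
  refine ⟨_, h1.add k1, ?_⟩
  filter_upwards [h2, k2] with x a b
  simp only [Pi.add_apply]
  linear_combination a + b

lemma IsSolution.smul {q : ℝ → ℝ} {z : ℂ} {φ φ' : ℝ → ℂ} (c : ℂ) (h : IsSolution q z φ φ') :
    IsSolution q z (c • φ) (c • φ') := by
  obtain ⟨φ'', h1, h2⟩ := h
  refine ⟨_, h1.smul c, ?_⟩
  filter_upwards [h2] with x a
  simp only [Pi.smul_apply, smul_eq_mul]
  linear_combination c * a

lemma IsSolution.comp_one_sub {q : ℝ → ℝ} (heven : ∀ᵐ x ∂edgeMeasure, q x = q (1 - x)) {z : ℂ}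
    {φ φ' : ℝ → ℂ} (h : IsSolution q z φ φ') :
    IsSolution q z (fun x => φ (1 - x)) (fun x => -φ' (1 - x)) := by
  obtain ⟨φ'', h1, h2⟩ := h
  refine ⟨_, h1.comp_one_sub, ?_⟩
  filter_upwards [heven, measurePreserving_one_sub.quasiMeasurePreserving.ae h2] with x a b
  rw [a]
  exact b

/-- A solution of the boundary value problem `φ 0 = 0`, `φ 1 = 0` vanishes outside the Dirichlet
spectrum. -/
lemma IsSolution.eqOn_zero_of_ends {q : ℝ → ℝ} {z : ℂ} (hz : z ∉ spectrum (dirichletOperator q)) {φ φ' : ℝ → ℂ} (h : IsSolution q z φ φ')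
    (h0 : φ 0 = 0) (h1 : φ 1 = 0) : EqOn φ 0 (Icc 0 1) ∧ EqOn φ' 0 (Icc 0 1) := by
  obtain ⟨R, -, hR⟩ := (mem_resolventSet_iff_graph (dirichletOperator_graph q)).1
    (not_not.1 hz)
  obtain ⟨φ'', k, hk⟩ := h
  set u : EdgeL2 := k.memLp_self.toLp with hu
  have hu' : u =ᵐ[edgeMeasure] φ := k.memLp_self.coeFn_toLp
  have hmem : (u, z • u) ∈ dirichletGraph q := by
    refine ⟨φ, φ', φ'', k, hu', h0, h1, ?_⟩
    filter_upwards [hu', hk, Lp.coeFn_smul z u] with x a b c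
    rw [c, Pi.smul_apply, a, b, smul_eq_mul]
  have := hR _ hmem
  simp only [sub_self, map_zero] at this
  have hφ : φ =ᵐ[edgeMeasure] 0 := by
    rw [← this] at hu'
    exact hu'.symm.trans (Lp.coeFn_zero ..)
  have e := k.eqOn_zero hφ
  exact ⟨e, k.deriv_eqOn_zero e⟩

lemma exists_solution {q : ℝ → ℝ} (hq : MemLp q 2 edgeMeasure) {z : ℂ}
    (hz : z ∉ spectrum (dirichletOperator q)) :
    ∃ φ φ' : ℝ → ℂ, IsSolution q z φ φ' ∧ φ 0 = 0 ∧ φ 1 = 1 := by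
  -- The solution is sought as `x + W` with `W` vanishing at both ends. Since `x'' = 0`, the
  -- right-hand side for `W` is `-(q - z) x`.
  obtain ⟨C, -, hC⟩ := exists_dirichlet_solution hq hz
  have hx : IsH2 (fun x : ℝ => (x : ℂ)) 1 0 :=
    IsH2.of_hasDerivAt (fun x => Complex.ofRealCLM.hasDerivAt (x := x))
      (fun x => hasDerivAt_const x 1) continuous_const
  have hp : MemLp (fun x : ℝ => -((q x : ℂ) - z) * x) 2 edgeMeasure := by
    have h2 := (hx.operator_memLp hq).sub (hx.memLp_self.const_smul z)
    refine h2.neg.ae_eq (.of_forall fun x => ?_)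
    simp
    ring
  obtain ⟨W, W', W'', h, h0, h1, hv, -⟩ := hC hp.toLp
  refine ⟨W + fun x : ℝ => (x : ℂ), W' + 1, ⟨W'' + 0, h.add hx, ?_⟩, by simp [h0], by simp [h1]⟩
  filter_upwards [hv, hp.coeFn_toLp] with x a b
  rw [b] at a
  simp only [Pi.add_apply, Pi.zero_apply]
  linear_combination -a

/-- Uniqueness for the Cauchy problem. -/
lemma IsSolution.eq_zero_of_initial {q : ℝ → ℝ} (hq : MemLp q 2 edgeMeasure) {z : ℂ}
    {φ φ' : ℝ → ℂ} (h : IsSolution q z φ φ') (h0 : φ 0 = 0) (h0' : φ' 0 = 0) {x : ℝ}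
    (hx : x ∈ Icc (0 : ℝ) 1) : φ x = 0 ∧ φ' x = 0 := by
  obtain ⟨φ'', k, hk⟩ := h
  have hcN : ContinuousOn (fun x => ‖φ x‖ + ‖φ' x‖) (Icc 0 1) :=
    k.continuousOn.norm.add k.continuousOn_deriv.norm
  have hp := memLp_potential_sub hq z
  -- The integrable Gronwall coefficient: `‖φ'‖ + ‖φ''‖ ≤ g (‖φ‖ + ‖φ'‖)` almost everywhere, as `φ''
  -- = (q - z) φ`.
  set g : ℝ → ℝ := fun x => 1 + ‖(q x : ℂ) - z‖ with hg
  have hgi : IntegrableOn g (Icc 0 1) :=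
    (integrable_const 1).add (hp.integrable (by norm_num)).norm
  have hgc : ContinuousOn (fun y => ∫ t in (0 : ℝ)..y, g t) (Icc 0 1) := by
    have := intervalIntegral.continuousOn_primitive_interval (f := g) (a := 0) (b := 1)
      (μ := volume) (by rwa [uIcc_of_le zero_le_one])
    rwa [uIcc_of_le zero_le_one] at this
  have hii : ∀ a ∈ Icc (0 : ℝ) 1, ∀ b ∈ Icc (0 : ℝ) 1, IntervalIntegrable g volume a b := by
    intro a ha b hb
    exact (hgi.mono_set (ordConnected_Icc.uIcc_subset ha hb)).intervalIntegrable
  suffices hs : Icc (0 : ℝ) 1 ⊆ {y | ‖φ y‖ + ‖φ' y‖ = 0} by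
    have := hs hx
    simp only [mem_ofPred_eq] at this
    constructor
    · exact norm_eq_zero.1 (by linarith [norm_nonneg (φ x), norm_nonneg (φ' x)])
    · exact norm_eq_zero.1 (by linarith [norm_nonneg (φ x), norm_nonneg (φ' x)])
  -- Continuous induction: the set where `φ` and `φ'` both vanish is closed, contains `0`, and
  -- extends to the right of each of its points.
  refine IsClosed.Icc_subset_of_forall_exists_gt ?_ (by simp [h0, h0']) ?_
  · have := hcN.preimage_isClosed_of_isClosed isClosed_Icc (isClosed_singleton (x := (0 : ℝ)))
    rwa [inter_comm] at this
  rintro a ⟨ha0, ha⟩ y hy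
  have haI : a ∈ Icc (0 : ℝ) 1 := Ico_subset_Icc_self ha
  have ha0' : ‖φ a‖ + ‖φ' a‖ = 0 := ha0
  have hφa : φ a = 0 := norm_eq_zero.1 (by linarith [norm_nonneg (φ a), norm_nonneg (φ' a)])
  have hφa' : φ' a = 0 := norm_eq_zero.1 (by linarith [norm_nonneg (φ a), norm_nonneg (φ' a)])
  obtain ⟨b, hab, hby, hb1, hb⟩ : ∃ b, a < b ∧ b ≤ y ∧ b ≤ 1 ∧ ∫ t in a..b, g t ≤ 1 / 2 := by
    have hcw : ContinuousWithinAt (fun y => ∫ t in (0 : ℝ)..y, g t) (Ioi a) a :=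
      (hgc a haI).mono_of_mem_nhdsWithin (Filter.mem_of_superset (Ioc_mem_nhdsGT ha.2)
        fun t ht => ⟨ha.1.trans ht.1.le, ht.2⟩)
    have hlt : ∀ᶠ b in nhdsWithin a (Ioi a),
        ∫ t in (0 : ℝ)..b, g t < (∫ t in (0 : ℝ)..a, g t) + 1 / 2 :=
      hcw.eventually_lt_const (by linarith)
    have h1 : ∀ᶠ b in nhdsWithin a (Ioi a), b ∈ Ioc a (min y 1) :=
      Ioc_mem_nhdsGT (lt_min hy ha.2)
    obtain ⟨b, hb, hb'⟩ := (hlt.and h1).exists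
    have hbI : b ∈ Icc (0 : ℝ) 1 := ⟨ha.1.trans hb'.1.le, hb'.2.trans (min_le_right _ _)⟩
    refine ⟨b, hb'.1, hb'.2.trans (min_le_left _ _), hbI.2, ?_⟩
    rw [← intervalIntegral.integral_interval_sub_left
      (hii 0 (by simp) b hbI) (hii 0 (by simp) a haI)]
    linarith
  have hsub : Icc a b ⊆ Icc 0 1 := Icc_subset_Icc ha.1 hb1
  -- The maximum `m` on `[a, b]` satisfies `m ≤ m * ∫ g ≤ m / 2`, since the solution vanishes at
  -- `a`; hence `m = 0`.
  obtain ⟨ξ, hξ, hmax⟩ := isCompact_Icc.exists_isMaxOn (nonempty_Icc.2 hab.le) (hcN.mono hsub)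
  set m := ‖φ ξ‖ + ‖φ' ξ‖ with hm
  have hm0 : 0 ≤ m := by positivity
  have hle : m ≤ m / 2 := by
    have e1 : φ ξ = ∫ t in a..ξ, φ' t := by
      rw [← sub_eq_integral_of_primitive k.memLp_deriv k.eq haI (hsub hξ), hφa, sub_zero]
    have e2 : φ' ξ = ∫ t in a..ξ, φ'' t := by
      rw [← sub_eq_integral_of_primitive k.memLp k.deriv_eq haI (hsub hξ), hφa', sub_zero]
    have hii' : ∀ {f : ℝ → ℂ}, MemLp f 2 edgeMeasure → IntervalIntegrable f volume a ξ :=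
      fun hf => (intervalIntegrable_of_memLp hf haI).symm.trans
        (intervalIntegrable_of_memLp hf (hsub hξ))
    have i1 := (hii' k.memLp_deriv).norm
    have i2 := (hii' k.memLp).norm
    calc m ≤ (∫ t in a..ξ, ‖φ' t‖) + ∫ t in a..ξ, ‖φ'' t‖ := by
          rw [hm, e1, e2]
          exact add_le_add (intervalIntegral.norm_integral_le_integral_norm hξ.1)
            (intervalIntegral.norm_integral_le_integral_norm hξ.1)
      _ = ∫ t in a..ξ, (‖φ' t‖ + ‖φ'' t‖) := (intervalIntegral.integral_add i1 i2).symm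
      _ ≤ ∫ t in a..ξ, m * g t := by
          refine intervalIntegral.integral_mono_ae_restrict hξ.1 (i1.add i2)
            ((hii a haI ξ (hsub hξ)).const_mul m) ?_
          have hk' := ae_mono (Measure.restrict_mono (μ := volume)
            ((Icc_subset_Icc_right hξ.2).trans hsub) le_rfl) hk
          filter_upwards [hk', ae_restrict_mem measurableSet_Icc] with t ht htm
          have hNt : ‖φ t‖ + ‖φ' t‖ ≤ m := hmax (Icc_subset_Icc_right hξ.2 htm)
          have e : φ'' t = ((q t : ℂ) - z) * φ t := by linear_combination -ht
          rw [e, norm_mul, hg]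
          nlinarith [norm_nonneg ((q t : ℂ) - z), norm_nonneg (φ t), norm_nonneg (φ' t)]
      _ = m * ∫ t in a..ξ, g t := intervalIntegral.integral_const_mul _ _
      _ ≤ m * (1 / 2) := by
          refine mul_le_mul_of_nonneg_left (le_trans ?_ hb) hm0
          have hbI : b ∈ Icc (0 : ℝ) 1 := hsub (right_mem_Icc.2 hab.le)
          refine intervalIntegral.integral_mono_interval le_rfl hξ.1 hξ.2
            (.of_forall fun t => ?_) (hii a haI b hbI)
          simp only [hg, Pi.zero_apply]
          positivity
      _ = m / 2 := by ring
  refine ⟨b, ?_, hab, hby⟩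
  have hbm : ‖φ b‖ + ‖φ' b‖ ≤ m := hmax (right_mem_Icc.2 hab.le)
  simp only [mem_ofPred_eq]
  linarith [norm_nonneg (φ b), norm_nonneg (φ' b)]

/-! ### The monodromy matrix -/

section Monodromy

variable {q : ℝ → ℝ} {z : ℂ} {φ φ' : ℝ → ℂ}

lemma IsSolution.deriv_zero_ne (hq : MemLp q 2 edgeMeasure) (h : IsSolution q z φ φ')
    (h0 : φ 0 = 0) (h1 : φ 1 = 1) : φ' 0 ≠ 0 := fun h' => by
  have := (h.eq_zero_of_initial hq h0 h' (right_mem_Icc.2 zero_le_one)).1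
  exact one_ne_zero (h1.symm.trans this)

/-- Outside the Dirichlet spectrum a solution is determined by its values at the end points. -/
lemma IsSolution.eq_combination (heven : ∀ᵐ x ∂edgeMeasure, q x = q (1 - x))
    (hz : z ∉ spectrum (dirichletOperator q)) (h : IsSolution q z φ φ') (h0 : φ 0 = 0)
    (h1 : φ 1 = 1) {χ χ' : ℝ → ℂ} (k : IsSolution q z χ χ') {x : ℝ} (hx : x ∈ Icc (0 : ℝ) 1) :
    χ x = χ 0 * φ (1 - x) + χ 1 * φ x ∧ χ' x = -χ 0 * φ' (1 - x) + χ 1 * φ' x := by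
  -- The difference of `χ` and the claimed combination is a solution vanishing at both ends.
  have hs := (k.add ((h.comp_one_sub heven).smul (-χ 0))).add (h.smul (-χ 1))
  obtain ⟨e, e'⟩ := hs.eqOn_zero_of_ends hz (by simp [h0, h1]) (by simp [h0, h1])
  have := e hx
  have := e' hx
  simp only [Pi.add_apply, Pi.smul_apply, smul_eq_mul, Pi.zero_apply] at *
  constructor
  · linear_combination ‹χ x + _ + _ = 0›
  · linear_combination ‹χ' x + _ + _ = 0›

/-- The solutions `φ(x)` and `φ(1 - x)` have initial data `(0, φ'(0))` and `(1, -φ'(1))`, which form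
a basis because `φ'(0) ≠ 0`, and final data `(1, φ'(1))` and `(0, -φ'(0))`. These four scalar
equations fix the matrix; conversely, `IsSolution.eq_combination` gives the end derivatives of any
solution in terms of its end values. -/
lemma isMonodromy_iff (hq : MemLp q 2 edgeMeasure)
    (heven : ∀ᵐ x ∂edgeMeasure, q x = q (1 - x))
    (hz : z ∉ spectrum (dirichletOperator q)) (h : IsSolution q z φ φ') (h0 : φ 0 = 0)
    (h1 : φ 1 = 1) (M : Matrix (Fin 2) (Fin 2) ℂ) : IsMonodromy q z M ↔
      M = !![φ' 1 / φ' 0, 1 / φ' 0; φ' 1 / φ' 0 * φ' 1 - φ' 0, φ' 1 / φ' 0] := by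
  have hκ := h.deriv_zero_ne hq h0 h1
  constructor
  · intro hM
    have a := hM _ _ h
    have b := hM _ _ (h.comp_one_sub heven)
    have a0 := congrFun a 0
    have a1 := congrFun a 1
    have b0 := congrFun b 0
    have b1 := congrFun b 1
    simp [h0, h1, Matrix.mulVec, dotProduct, Fin.sum_univ_two] at a0 a1 b0 b1
    have e01 : M 0 1 = 1 / φ' 0 := by field_simp; exact a0.symm
    have e11 : M 1 1 = φ' 1 / φ' 0 := by field_simp; exact a1.symm
    have e00 : M 0 0 = φ' 1 / φ' 0 := by
      rw [e01] at b0
      linear_combination -b0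
    have e10 : M 1 0 = φ' 1 / φ' 0 * φ' 1 - φ' 0 := by
      rw [e11] at b1
      linear_combination -b1
    ext i j
    fin_cases i <;> fin_cases j <;> simp [e00, e01, e10, e11]
  · rintro rfl χ χ' k
    have e0 := (h.eq_combination heven hz h0 h1 k (left_mem_Icc.2 zero_le_one)).2
    have e1 := (h.eq_combination heven hz h0 h1 k (right_mem_Icc.2 zero_le_one)).2
    simp only [sub_zero, sub_self] at e0 e1
    ext i
    fin_cases i
    · simp [Matrix.mulVec, dotProduct, Fin.sum_univ_two, e0]
      field_simp
      ring
    · simp [Matrix.mulVec, dotProduct, Fin.sum_univ_two, e0, e1]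
      field_simp
      ring

end Monodromy

/-! ### Square summable families -/

section SquareSummable

variable {ι E : Type*} [NormedAddCommGroup E]

lemma memℓp_two_of_tsum_ne_top {f : ι → E} (h : ∑' i, ‖f i‖ₑ ^ 2 ≠ ∞) : Memℓp f 2 := by
  refine memℓp_gen ((ENNReal.summable_toReal h).congr fun i => ?_)
  simp [ENNReal.toReal_pow]

lemma enorm_sq_eq_tsum (f : lp (fun _ : ι => E) 2) : ‖f‖ₑ ^ 2 = ∑' i, ‖f i‖ₑ ^ 2 := by
  have hs := lp.hasSum_norm (p := 2) (by norm_num) f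
  simp only [ENNReal.toReal_ofNat, Real.rpow_ofNat] at hs
  have e : ∀ x : E, ‖x‖ₑ ^ 2 = ENNReal.ofReal (‖x‖ ^ 2) := fun x => by
    rw [ENNReal.ofReal_pow (norm_nonneg x), ofReal_norm]
  calc ‖f‖ₑ ^ 2 = ENNReal.ofReal (‖f‖ ^ 2) := by
        rw [ENNReal.ofReal_pow (norm_nonneg f), ofReal_norm]
    _ = ∑' i, ‖f i‖ₑ ^ 2 := by
        rw [← hs.tsum_eq, ENNReal.ofReal_tsum_of_nonneg (fun i => by positivity) hs.summable]
        exact tsum_congr fun i => (e _).symm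

lemma enorm_sum_fin_three_sq_le (x : Fin 3 → ℂ) : ‖∑ t, x t‖ₑ ^ 2 ≤ 3 * ∑ t, ‖x t‖ₑ ^ 2 := by
  have hr : ‖∑ t, x t‖₊ ^ 2 ≤ 3 * ∑ t, ‖x t‖₊ ^ 2 := by
    rw [← NNReal.coe_le_coe]
    push_cast
    have h := norm_sum_le Finset.univ x
    have h2 := sq_sum_le_card_mul_sum_sq (s := Finset.univ) (f := fun t => ‖x t‖)
    simp only [Finset.card_univ, Fintype.card_fin, Nat.cast_ofNat] at h2
    exact (pow_le_pow_left₀ (norm_nonneg _) h 2).trans h2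
  simp only [enorm_eq_nnnorm]
  exact_mod_cast hr

/-- The unitary operator on `ℓ²` induced by a permutation of the index set. -/
def permOperator (σ : Equiv.Perm ι) :
    lp (fun _ : ι => ℂ) 2 →L[ℂ] lp (fun _ : ι => ℂ) 2 :=
  LinearMap.mkContinuous
    { toFun := fun f => ⟨fun i => f (σ i), memℓp_two_of_tsum_ne_top (by
        rw [σ.tsum_eq (fun i => ‖f i‖ₑ ^ 2), ← enorm_sq_eq_tsum]
        finiteness)⟩
      map_add' := fun _ _ => rfl
      map_smul' := fun _ _ => rfl } 1 fun f => by
    rw [one_mul, ← enorm_le_iff_norm_le, ← ENNReal.pow_le_pow_left_iff two_ne_zero,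
      enorm_sq_eq_tsum, enorm_sq_eq_tsum]
    exact (σ.tsum_eq (fun i => ‖f i‖ₑ ^ 2)).le

lemma permOperator_apply (σ : Equiv.Perm ι) (f : lp (fun _ : ι => ℂ) 2) (i : ι) :
    permOperator σ f i = f (σ i) := rfl

lemma norm_permOperator_le (σ : Equiv.Perm ι) : ‖permOperator σ‖ ≤ 1 :=
  LinearMap.mkContinuous_norm_le _ zero_le_one _

/-- Reindexing the inner product by `σ` moves the operator to the other argument, since `σ` is its
own inverse. -/
lemma isSelfAdjoint_permOperator {σ : Equiv.Perm ι} (hσ : Function.Involutive σ) :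
    IsSelfAdjoint (permOperator σ) := by
  rw [ContinuousLinearMap.isSelfAdjoint_iff_isSymmetric]
  intro f g
  simp only [ContinuousLinearMap.coe_coe]
  rw [lp.inner_eq_tsum, lp.inner_eq_tsum, ← σ.tsum_eq]
  simp only [permOperator_apply, hσ _]

end SquareSummable

/-! ### The adjacency operator of the hexagonal lattice -/

/-- The vertex joined to a given one by an edge of a given type. -/
def Vertex.neighbor (t : Fin 3) : Vertex → Vertex
  | .a p => .b (p - shift t)
  | .b p => .a (p + shift t)

lemma Vertex.neighbor_involutive (t : Fin 3) : Function.Involutive (Vertex.neighbor t) := by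
  rintro (p | p) <;> simp [Vertex.neighbor]

/-- `ℓ²` of the vertices. -/
abbrev VertexL2 : Type := lp (fun _ : Vertex => ℂ) 2

/-- The adjacency operator of the hexagonal lattice. -/
def adjacency : VertexL2 →L[ℂ] VertexL2 :=
  ∑ t, permOperator (Vertex.neighbor_involutive t).toPerm

lemma adjacency_apply (f : VertexL2) (v : Vertex) :
    adjacency f v = ∑ t, f (v.neighbor t) := by
  simp [adjacency, permOperator_apply, Fin.sum_univ_three]

lemma isSelfAdjoint_adjacency : IsSelfAdjoint adjacency :=
  isSelfAdjoint_sum _ fun t _ => isSelfAdjoint_permOperator (Vertex.neighbor_involutive t)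

lemma norm_adjacency_le : ‖adjacency‖ ≤ 3 := by
  refine (norm_sum_le _ _).trans ?_
  calc _ ≤ ∑ _ : Fin 3, (1 : ℝ) := Finset.sum_le_sum fun t _ => norm_permOperator_le _
    _ = 3 := by simp

lemma mem_spectrum_adjacency {μ : ℂ} (h : μ ∈ _root_.spectrum ℂ adjacency) :
    ∃ r : ℝ, |r| ≤ 3 ∧ μ = r := by
  have hn : ‖μ‖ ≤ 3 := (spectrum.norm_le_norm_mul_of_mem h).trans (by
    have := norm_adjacency_le
    have h1 : ‖(1 : VertexL2 →L[ℂ] VertexL2)‖ ≤ 1 := ContinuousLinearMap.norm_id_le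
    nlinarith [norm_nonneg adjacency])
  exact ⟨μ.re, (Complex.abs_re_le_norm μ).trans hn, isSelfAdjoint_adjacency.mem_spectrum_eq_re h⟩

lemma algebraMap_sub_adjacency_apply (μ : ℂ) (f : VertexL2) (v : Vertex) :
    (algebraMap ℂ (VertexL2 →L[ℂ] VertexL2) μ - adjacency) f v =
      μ * f v - ∑ t, f (v.neighbor t) := by
  rw [← adjacency_apply]
  rfl

/-- Outside the spectrum of the adjacency operator, the difference equation on the vertices has a
unique square summable solution, with an estimate. -/
lemma exists_adjacency_solution {μ : ℂ} (hμ : μ ∉ _root_.spectrum ℂ adjacency) :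
    ∃ C : ℝ≥0∞, C ≠ ∞ ∧ ∀ g : Vertex → ℂ, ∑' v, ‖g v‖ₑ ^ 2 ≠ ∞ → ∃ f : Vertex → ℂ,
      ∑' v, ‖f v‖ₑ ^ 2 ≤ C * ∑' v, ‖g v‖ₑ ^ 2 ∧
      ∀ v, ∑ t, f (v.neighbor t) - μ * f v = g v := by
  obtain ⟨S, hS⟩ := (spectrum.notMem_iff.1 hμ).exists_right_inv
  refine ⟨‖S‖ₑ ^ 2, by finiteness, fun g hg => ?_⟩
  set G : VertexL2 := ⟨g, memℓp_two_of_tsum_ne_top hg⟩ with hG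
  have hGn : ‖G‖ₑ ^ 2 = ∑' v, ‖g v‖ₑ ^ 2 := enorm_sq_eq_tsum G
  -- The minus sign appears because `S` inverts `μ - A`, whereas the difference equation involves `A
  -- - μ`.
  refine ⟨⇑(-S G), ?_, fun v => ?_⟩
  · rw [← enorm_sq_eq_tsum, ← hGn, ← mul_pow, enorm_neg]
    gcongr
    exact S.le_opENorm G
  · have h1 : (algebraMap ℂ (VertexL2 →L[ℂ] VertexL2) μ - adjacency) (S G) = G :=
      congrArg (fun T : VertexL2 →L[ℂ] VertexL2 => T G) hS
    have h2 := congrArg (fun F : VertexL2 => F v) h1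
    simp only [algebraMap_sub_adjacency_apply] at h2
    have h3 : G v = g v := rfl
    simp only [lp.coeFn_neg, Pi.neg_apply, Finset.sum_neg_distrib]
    linear_combination h2 + h3

lemma eq_zero_of_adjacency {μ : ℂ} (hμ : μ ∉ _root_.spectrum ℂ adjacency) {f : Vertex → ℂ}
    (hf : ∑' v, ‖f v‖ₑ ^ 2 ≠ ∞) (h : ∀ v, ∑ t, f (v.neighbor t) - μ * f v = 0) : f = 0 := by
  obtain ⟨S, hS⟩ := (spectrum.notMem_iff.1 hμ).exists_left_inv
  set F : VertexL2 := ⟨f, memℓp_two_of_tsum_ne_top hf⟩ with hF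
  have h0 : (algebraMap ℂ (VertexL2 →L[ℂ] VertexL2) μ - adjacency) F = 0 := by
    ext v
    rw [algebraMap_sub_adjacency_apply]
    exact (neg_sub _ _).symm.trans (neg_eq_zero.2 (h v))
  have h1 : S ((algebraMap ℂ (VertexL2 →L[ℂ] VertexL2) μ - adjacency) F) = F :=
    congrArg (fun T : VertexL2 →L[ℂ] VertexL2 => T F) hS
  rw [h0, map_zero] at h1
  exact (congrArg (fun G : VertexL2 => ⇑G) h1).symm

/-! ### Summation over vertices and edges -/

/-- The two families of vertices. -/
def Vertex.equivSum : (ℤ × ℤ) ⊕ (ℤ × ℤ) ≃ Vertex where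
  toFun := Sum.elim .a .b
  invFun
    | .a p => .inl p
    | .b p => .inr p
  left_inv := by rintro (p | p) <;> rfl
  right_inv := by rintro (p | p) <;> rfl

lemma tsum_vertex (F : Vertex → ℝ≥0∞) :
    ∑' v, F v = ∑' p, F (.a p) + ∑' p, F (.b p) := by
  rw [← Vertex.equivSum.tsum_eq F, ENNReal.summable.tsum_sum ENNReal.summable]
  rfl

lemma tsum_edge (F : Edge → ℝ≥0∞) : ∑' e, F e = ∑ t, ∑' p, F (p, t) := by
  rw [ENNReal.tsum_prod', ENNReal.tsum_comm, tsum_fintype]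

lemma tsum_source (F : Vertex → ℝ≥0∞) : ∑' e : Edge, F e.source = 3 * ∑' p, F (.a p) := by
  simp [tsum_edge, Edge.source]

lemma tsum_target (F : Vertex → ℝ≥0∞) : ∑' e : Edge, F e.target = 3 * ∑' p, F (.b p) := by
  simp only [tsum_edge, Edge.target]
  have : ∀ t, ∑' p : ℤ × ℤ, F (.b (p - shift t)) = ∑' p, F (.b p) := fun t =>
    (Equiv.subRight (shift t)).tsum_eq fun p => F (.b p)
  simp [this]

/-- Every vertex is an end point of exactly three edges. -/
lemma tsum_ends (F : Vertex → ℝ≥0∞) :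
    ∑' e : Edge, (F e.source + F e.target) = 3 * ∑' v, F v := by
  rw [ENNReal.tsum_add, tsum_source, tsum_target, tsum_vertex, mul_add]

/-- Every edge is counted once at each of its two end points. -/
lemma tsum_vertex_edge (F : Edge → ℝ≥0∞) :
    ∑' v : Vertex, ∑ t, F (v.edge t) = 2 * ∑' e, F e := by
  have : ∀ t, ∑' p : ℤ × ℤ, F (p + shift t, t) = ∑' p, F (p, t) := fun t =>
    (Equiv.addRight (shift t)).tsum_eq fun p => F (p, t)
  simp only [tsum_vertex, Vertex.edge]
  rw [Summable.tsum_finsetSum fun _ _ => ENNReal.summable,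
    Summable.tsum_finsetSum fun _ _ => ENNReal.summable]
  simp only [this, ← tsum_edge]
  ring

/-! ### A criterion for the resolvent set -/

/-- Solutions may be chosen arbitrarily: the trivial kernel makes them unique, and uniqueness makes
the chosen map linear. The bound on squares gives operator bound `√C`. -/
lemma mem_resolventSet_of_bound {X : Type*} [NormedAddCommGroup X] [NormedSpace ℂ X]
    {T : X →ₗ.[ℂ] X} {G : Submodule ℂ (X × X)} (hT : T.graph = G) {z : ℂ} {C : ℝ≥0∞}
    (hC : C ≠ ∞) (hex : ∀ v, ∃ u, (u, v + z • u) ∈ G ∧ ‖u‖ₑ ^ 2 ≤ C * ‖v‖ₑ ^ 2)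
    (hker : ∀ u, (u, z • u) ∈ G → u = 0) : z ∈ resolventSet T := by
  rw [mem_resolventSet_iff_graph hT]
  choose R hR hb using hex
  have huniq : ∀ u v, (u, v + z • u) ∈ G → R v = u := fun u v hu => by
    refine sub_eq_zero.1 (hker _ ?_)
    have := G.sub_mem (hR v) hu
    simpa [smul_sub] using this
  lift C to NNReal using hC
  refine ⟨LinearMap.mkContinuousOfExistsBound
    { toFun := R
      map_add' := fun v w => huniq _ _ ?_
      map_smul' := fun c v => huniq _ _ ?_ } ⟨√C, fun v => ?_⟩, hR, fun w hw => huniq _ _ ?_⟩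
  · have := G.add_mem (hR v) (hR w)
    simp only [Prod.mk_add_mk] at this
    convert this using 2
    rw [smul_add]
    abel
  · have := G.smul_mem c (hR v)
    rwa [Prod.smul_mk, smul_add, smul_comm c z] at this
  · have h2 : ‖R v‖ ^ 2 ≤ C * ‖v‖ ^ 2 := by
      have := hb v
      simp only [enorm_eq_nnnorm] at this
      exact_mod_cast this
    change ‖R v‖ ≤ √C * ‖v‖
    rw [← Real.sqrt_sq (norm_nonneg (R v)), ← Real.sqrt_sq (norm_nonneg v),
      ← Real.sqrt_mul (NNReal.coe_nonneg C)]
    exact Real.sqrt_le_sqrt (by simpa using h2)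
  · simpa using hw

/-! ### Functions on the graph with prescribed values at the vertices -/

lemma enorm_sq_eq_lintegral {w : EdgeL2} {U : ℝ → ℂ} (h : w =ᵐ[edgeMeasure] U) :
    ‖w‖ₑ ^ 2 = ∫⁻ x, ‖U x‖ₑ ^ 2 ∂edgeMeasure := by
  rw [lintegral_enorm_sq_eq, ← eLpNorm_congr_ae h, Lp.enorm_def]

lemma lintegral_enorm_sq_le_h2NormSq (U U' U'' : ℝ → ℂ) :
    ∫⁻ x, ‖U x‖ₑ ^ 2 ∂edgeMeasure ≤ h2NormSq U U' U'' :=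
  lintegral_mono fun x => by rw [add_assoc]; exact le_self_add

lemma IsH2.exists_lp {U U' U'' : Edge → ℝ → ℂ} (h : ∀ e, IsH2 (U e) (U' e) (U'' e))
    (hn : ∑' e, h2NormSq (U e) (U' e) (U'' e) ≠ ∞) : ∃ u : GraphL2,
      (∀ e, u e =ᵐ[edgeMeasure] U e) ∧ ‖u‖ₑ ^ 2 ≤ ∑' e, h2NormSq (U e) (U' e) (U'' e) := by
  have hle : ∀ e, ‖(h e).memLp_self.toLp‖ₑ ^ 2 ≤ h2NormSq (U e) (U' e) (U'' e) := fun e => by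
    rw [enorm_sq_eq_lintegral (h e).memLp_self.coeFn_toLp]
    exact lintegral_enorm_sq_le_h2NormSq _ _ _
  have ht := ENNReal.tsum_le_tsum hle
  refine ⟨⟨fun e => (h e).memLp_self.toLp, memℓp_two_of_tsum_ne_top (ne_top_of_le_ne_top hn ht)⟩,
    fun e => (h e).memLp_self.coeFn_toLp, ?_⟩
  rw [enorm_sq_eq_tsum]
  exact ht

/-- Treats both kinds of vertices at once: with `g = φ`, `φ(0) = 0` and `φ(1) = 1`, it says that the
glued function takes the value `f v` at `v` on each edge there. -/
lemma Vertex.edge_ends (f : Vertex → ℂ) (v : Vertex) (t : Fin 3) (g : ℝ → ℂ) :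
    (f (v.edge t).source * g (1 - v.coord) + f (v.edge t).target * g v.coord =
      f v * g 1 + f (v.neighbor t) * g 0) := by
  cases v with
  | a p => simp [Vertex.edge, Edge.source, Edge.target, Vertex.coord, Vertex.neighbor]
  | b p => simp [Vertex.edge, Edge.source, Edge.target, Vertex.coord, Vertex.neighbor, add_comm]

/-- With `g = φ'` the left side is the outgoing derivative of the glued function along one edge.
Summing over the three edges produces the adjacency operator. -/
lemma Vertex.edge_ends_deriv (f : Vertex → ℂ) (v : Vertex) (t : Fin 3) (g : ℝ → ℂ) :
    v.sign * (f (v.edge t).source * -g (1 - v.coord) + f (v.edge t).target * g v.coord) =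
      f (v.neighbor t) * g 0 - f v * g 1 := by
  cases v with
  | a p =>
    simp [Vertex.edge, Edge.source, Edge.target, Vertex.coord, Vertex.neighbor, Vertex.sign]
    ring
  | b p =>
    simp [Vertex.edge, Edge.source, Edge.target, Vertex.coord, Vertex.neighbor, Vertex.sign]
    ring

section Extension

variable {q : ℝ → ℝ} {z : ℂ} {φ φ' : ℝ → ℂ}

/-- Vertex values `f` and functions `W e` that vanish at the end points define a function in the
domain of the Hamiltonian, provided that they balance in the vertex conditions. -/
lemma exists_mem_hamiltonianGraph (heven : ∀ᵐ x ∂edgeMeasure, q x = q (1 - x))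
    (h : IsSolution q z φ φ') (h0 : φ 0 = 0) (h1 : φ 1 = 1) (hκ : φ' 0 ≠ 0) :
    ∃ C : ℝ≥0∞, C ≠ ∞ ∧ ∀ (f : Vertex → ℂ) (W W' W'' : Edge → ℝ → ℂ) (v : GraphL2),
      (∀ e, IsH2 (W e) (W' e) (W'' e)) → (∀ e, W e 0 = 0) → (∀ e, W e 1 = 0) →
      (∀ e, v e =ᵐ[edgeMeasure] fun x => -W'' e x + q x * W e x - z * W e x) →
      (∀ y : Vertex, φ' 0 * (∑ t, f (y.neighbor t) - 3 * (φ' 1 / φ' 0) * f y) +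
        ∑ t, y.sign * W' (y.edge t) y.coord = 0) →
      ∑' y, ‖f y‖ₑ ^ 2 ≠ ∞ → ∑' e, h2NormSq (W e) (W' e) (W'' e) ≠ ∞ →
      ∃ u : GraphL2, (u, v + z • u) ∈ hamiltonianGraph q ∧
        ‖u‖ₑ ^ 2 ≤ C * (∑' y, ‖f y‖ₑ ^ 2 + ∑' e, h2NormSq (W e) (W' e) (W'' e)) ∧
        ∀ e, u e =ᵐ[edgeMeasure]
          fun x => f e.source * φ (1 - x) + f e.target * φ x + W e x := by
  obtain ⟨ψ'', hψ, hψe⟩ := h.comp_one_sub heven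
  obtain ⟨φ'', hφ, hφe⟩ := h
  set ψ : ℝ → ℂ := fun x => φ (1 - x) with hψ_def
  set ψ' : ℝ → ℂ := fun x => -φ' (1 - x) with hψ'_def
  -- From `‖a + b + c‖² ≤ 4‖a‖² + 4‖b‖² + 2‖c‖²`, with the two solutions and `W e` as summands.
  set C₀ := 4 * h2NormSq ψ ψ' ψ'' + 4 * h2NormSq φ φ' φ'' + 2 with hC₀
  have hC₀t : C₀ ≠ ∞ := by
    have := hφ.norm_lt_top
    have := hψ.norm_lt_top
    finiteness
  refine ⟨3 * C₀, by finiteness, fun f W W' W'' v hW hW0 hW1 hv hflux hf hWn => ?_⟩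
  have hU : ∀ e : Edge, IsH2 (f e.source • ψ + f e.target • φ + W e)
      (f e.source • ψ' + f e.target • φ' + W' e)
      (f e.source • ψ'' + f e.target • φ'' + W'' e) := fun e =>
    ((hψ.smul _).add (hφ.smul _)).add (hW e)
  have hle : ∀ e : Edge, h2NormSq (f e.source • ψ + f e.target • φ + W e)
      (f e.source • ψ' + f e.target • φ' + W' e) (f e.source • ψ'' + f e.target • φ'' + W'' e) ≤
      C₀ * ((‖f e.source‖ₑ ^ 2 + ‖f e.target‖ₑ ^ 2) + h2NormSq (W e) (W' e) (W'' e)) := by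
    intro e
    refine (((hψ.smul _).add (hφ.smul _)).h2NormSq_add_le).trans ?_
    refine (add_le_add (mul_le_mul_right (hψ.smul _).h2NormSq_add_le 2) le_rfl).trans ?_
    rw [IsH2.h2NormSq_smul, IsH2.h2NormSq_smul]
    calc _ = ‖f e.source‖ₑ ^ 2 * (4 * h2NormSq ψ ψ' ψ'') +
          ‖f e.target‖ₑ ^ 2 * (4 * h2NormSq φ φ' φ'') + h2NormSq (W e) (W' e) (W'' e) * 2 := by
          ring
      _ ≤ ‖f e.source‖ₑ ^ 2 * C₀ + ‖f e.target‖ₑ ^ 2 * C₀ +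
          h2NormSq (W e) (W' e) (W'' e) * C₀ := by
          gcongr
          · rw [hC₀, add_assoc]; exact le_self_add
          · rw [hC₀, add_right_comm]; exact le_add_self
          · exact le_add_self
      _ = _ := by ring
  have hsum : ∑' e : Edge, h2NormSq (f e.source • ψ + f e.target • φ + W e)
      (f e.source • ψ' + f e.target • φ' + W' e) (f e.source • ψ'' + f e.target • φ'' + W'' e) ≤
      3 * C₀ * (∑' y, ‖f y‖ₑ ^ 2 + ∑' e, h2NormSq (W e) (W' e) (W'' e)) := by
    refine (ENNReal.tsum_le_tsum hle).trans ?_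
    rw [ENNReal.tsum_mul_left, ENNReal.tsum_add, tsum_ends fun y => ‖f y‖ₑ ^ 2]
    calc _ ≤ C₀ * (3 * ∑' y, ‖f y‖ₑ ^ 2 + 3 * ∑' e, h2NormSq (W e) (W' e) (W'' e)) := by
          gcongr
          exact le_mul_of_one_le_left zero_le (by norm_num)
      _ = _ := by ring
  have hfin := ne_top_of_le_ne_top (b := 3 * C₀ * (∑' y, ‖f y‖ₑ ^ 2 +
    ∑' e, h2NormSq (W e) (W' e) (W'' e))) (by finiteness) hsum
  obtain ⟨u, hu, hun⟩ := IsH2.exists_lp hU hfin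
  refine ⟨u, ⟨_, _, _, ⟨hU, hu, hfin.lt_top, ?_, ?_⟩, fun e => ?_⟩, hun.trans hsum, hu⟩
  · have hval : ∀ (y : Vertex) (t : Fin 3), (f (y.edge t).source • ψ + f (y.edge t).target • φ +
        W (y.edge t)) y.coord = f y := by
      intro y t
      have hWy : W (y.edge t) y.coord = 0 := by
        cases y with
        | a p => exact hW0 _
        | b p => exact hW1 _
      simp only [Pi.add_apply, Pi.smul_apply, smul_eq_mul, hWy, hψ_def, Vertex.edge_ends, h0, h1]
      ring
    intro y s t
    rw [hval, hval]
  · intro y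
    simp only [Pi.add_apply, Pi.smul_apply, smul_eq_mul, hψ'_def, mul_add (Vertex.sign _) (_ + _),
      Vertex.edge_ends_deriv]
    rw [← hflux y, Finset.sum_add_distrib, Finset.sum_sub_distrib, ← Finset.sum_mul]
    simp only [Finset.sum_const, Finset.card_univ, Fintype.card_fin, nsmul_eq_mul]
    field_simp
    push_cast
    ring
  · filter_upwards [hu e, hv e, hφe, hψe, Lp.coeFn_add (v e) (z • u e), Lp.coeFn_smul z (u e)]
      with x a b c d i j
    have i' : (v + z • u) e x = (v e + z • u e) x := rfl
    rw [i', i, Pi.add_apply, j, Pi.smul_apply, a, b]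
    simp only [Pi.add_apply, Pi.smul_apply, smul_eq_mul]
    linear_combination (-f e.target) * c - f e.source * d

end Extension

/-! ### The resolvent of the Hamiltonian -/

section Resolvent

variable {q : ℝ → ℝ} {z : ℂ} {φ φ' : ℝ → ℂ}

/-- An eigenfunction is glued from its vertex values. These are square summable, by the bound of
point values by the `H²`-norm, and the flux condition makes them a solution of `A f = 3η f`; hence
they vanish, and so does the function. -/
lemma eq_zero_of_mem_hamiltonianGraph (heven : ∀ᵐ x ∂edgeMeasure, q x = q (1 - x))
    (hz : z ∉ spectrum (dirichletOperator q)) (h : IsSolution q z φ φ') (h0 : φ 0 = 0)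
    (h1 : φ 1 = 1) (hκ : φ' 0 ≠ 0) (hμ : 3 * (φ' 1 / φ' 0) ∉ _root_.spectrum ℂ adjacency)
    {u : GraphL2} (hu : (u, z • u) ∈ hamiltonianGraph q) : u = 0 := by
  obtain ⟨U, U', U'', hd, he⟩ := hu
  have hsol : ∀ e, IsSolution q z (U e) (U' e) := fun e => by
    refine ⟨U'' e, hd.isH2 e, ?_⟩
    filter_upwards [he e, hd.ae_eq e, Lp.coeFn_smul z (u e)] with x a b c
    rw [← a, ← b]
    exact c
  set f : Vertex → ℂ := fun y => U (y.edge 0) y.coord with hf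
  have hval : ∀ (y : Vertex) (t : Fin 3), U (y.edge t) y.coord = f y := fun y t =>
    hd.continuity y t 0
  have hs : ∀ e : Edge, U e 0 = f e.source := fun e => hval (.a e.1) e.2
  have ht : ∀ e : Edge, U e 1 = f e.target := fun e => by
    have := hval e.target e.2
    simpa [Edge.target, Vertex.edge, Vertex.coord] using this
  have hcomb := fun (e : Edge) {x : ℝ} (hx : x ∈ Icc (0 : ℝ) 1) =>
    h.eq_combination heven hz h0 h1 (hsol e) hx
  have hfn : ∑' y, ‖f y‖ₑ ^ 2 ≠ ∞ := by
    have h3 : 3 * ∑' y, ‖f y‖ₑ ^ 2 ≤ 4 * ∑' e, h2NormSq (U e) (U' e) (U'' e) := by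
      rw [← tsum_ends fun y => ‖f y‖ₑ ^ 2, ← ENNReal.tsum_mul_left]
      refine ENNReal.tsum_le_tsum fun e => ?_
      rw [← hs, ← ht]
      calc _ ≤ 2 * h2NormSq (U e) (U' e) (U'' e) + 2 * h2NormSq (U e) (U' e) (U'' e) :=
            add_le_add ((hd.isH2 e).sup_le (left_mem_Icc.2 zero_le_one))
              ((hd.isH2 e).sup_le (right_mem_Icc.2 zero_le_one))
        _ = _ := by ring
    have hlt : 3 * ∑' y, ‖f y‖ₑ ^ 2 ≠ ∞ := ne_top_of_le_ne_top
      (ENNReal.mul_ne_top (by norm_num) hd.norm_finite.ne) h3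
    intro htop
    simp [htop] at hlt
  have hf0 : f = 0 := by
    refine eq_zero_of_adjacency hμ hfn fun y => ?_
    have hfl := hd.flux y
    have hy : y.coord ∈ Icc (0 : ℝ) 1 := by cases y <;> simp [Vertex.coord]
    have hterm : ∀ t, y.sign * U' (y.edge t) y.coord =
        f (y.neighbor t) * φ' 0 - f y * φ' 1 := fun t => by
      rw [← Vertex.edge_ends_deriv, (hcomb _ hy).2, hs, ht]
      ring
    simp only [hterm, Finset.sum_sub_distrib, ← Finset.sum_mul, Finset.sum_const,
      Finset.card_univ, Fintype.card_fin, nsmul_eq_mul] at hfl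
    push_cast at hfl
    field_simp
    linear_combination hfl
  ext1
  funext e
  refine Lp.eq_zero_iff_ae_eq_zero.2 ?_
  filter_upwards [hd.ae_eq e, ae_restrict_mem measurableSet_Icc] with x a hx
  rw [a, (hcomb e hx).1, hs, ht, hf0]
  simp

/-- The equation is first solved with Dirichlet conditions on every edge, which leaves a flux defect
at the vertices; a glued solution of the homogeneous equation then removes it, with vertex values
obtained by inverting `A - 3η`. -/
lemma mem_resolventSet_hamiltonian (hq : MemLp q 2 edgeMeasure)
    (heven : ∀ᵐ x ∂edgeMeasure, q x = q (1 - x))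
    (hz : z ∉ spectrum (dirichletOperator q)) (h : IsSolution q z φ φ') (h0 : φ 0 = 0)
    (h1 : φ 1 = 1) (hμ : 3 * (φ' 1 / φ' 0) ∉ _root_.spectrum ℂ adjacency) :
    z ∈ resolventSet (hamiltonian q) := by
  have hκ := h.deriv_zero_ne hq h0 h1
  obtain ⟨C₁, hC₁, hdir⟩ := exists_dirichlet_solution hq hz
  obtain ⟨C₂, hC₂, hadj⟩ := exists_adjacency_solution hμ
  obtain ⟨C₃, hC₃, hext⟩ := exists_mem_hamiltonianGraph heven h h0 h1 hκ
  set k := ‖(φ' 0)⁻¹‖ₑ with hk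
  refine mem_resolventSet_of_bound (hamiltonian_graph q)
    (C := C₃ * (C₂ * (k ^ 2 * (6 * C₁)) + C₁)) (by finiteness) (fun v => ?_)
    fun u hu => eq_zero_of_mem_hamiltonianGraph heven hz h h0 h1 hκ hμ hu
  choose W W' W'' hW hW0 hW1 hv hn hd0 hd1 using fun e => hdir (v e)
  have hvn : ∑' e, ‖v e‖ₑ ^ 2 = ‖v‖ₑ ^ 2 := (enorm_sq_eq_tsum v).symm
  have hnsum : ∑' e, h2NormSq (W e) (W' e) (W'' e) ≤ C₁ * ‖v‖ₑ ^ 2 := by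
    rw [← hvn, ← ENNReal.tsum_mul_left]
    exact ENNReal.tsum_le_tsum hn
  have hnfin := ne_top_of_le_ne_top (b := C₁ * ‖v‖ₑ ^ 2) (by finiteness) hnsum
  -- The flux defect divided by `-φ'(0)`: vertex values `f` with `(A - 3η) f = g` contribute the
  -- flux `φ'(0) g`, which cancels the defect.
  set g : Vertex → ℂ := fun y => -((φ' 0)⁻¹ * ∑ t, y.sign * W' (y.edge t) y.coord) with hg
  have hgle : ∀ y, ‖g y‖ₑ ^ 2 ≤ k ^ 2 * (3 * C₁) * ∑ t, ‖v (y.edge t)‖ₑ ^ 2 := by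
    intro y
    rw [hg]
    simp only [enorm_neg, enorm_mul, mul_pow]
    rw [mul_assoc, mul_assoc]
    refine mul_le_mul_right ((enorm_sum_fin_three_sq_le _).trans
      (mul_le_mul_right ?_ _)) _
    rw [Finset.mul_sum]
    refine Finset.sum_le_sum fun t _ => ?_
    cases y with
    | a p => simpa [Vertex.sign, Vertex.coord] using hd0 _
    | b p => simpa [Vertex.sign, Vertex.coord] using hd1 _
  -- The factor `6` is `3` from the square of a sum over three edges times `2` from each edge
  -- meeting two vertices.
  have hgsum : ∑' y, ‖g y‖ₑ ^ 2 ≤ k ^ 2 * (6 * C₁) * ‖v‖ₑ ^ 2 := by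
    refine (ENNReal.tsum_le_tsum hgle).trans ?_
    rw [ENNReal.tsum_mul_left, tsum_vertex_edge fun e => ‖v e‖ₑ ^ 2, hvn]
    exact le_of_eq (by ring)
  obtain ⟨f, hfg, hfe⟩ := hadj g
    (ne_top_of_le_ne_top (b := k ^ 2 * (6 * C₁) * ‖v‖ₑ ^ 2) (by finiteness) hgsum)
  have hfsum : ∑' y, ‖f y‖ₑ ^ 2 ≤ C₂ * (k ^ 2 * (6 * C₁) * ‖v‖ₑ ^ 2) := hfg.trans (by gcongr)
  obtain ⟨u, hu, hun, -⟩ := hext f W W' W'' v hW hW0 hW1 hv (fun y => by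
      rw [hfe y, hg]
      field_simp
      ring)
    (ne_top_of_le_ne_top (b := C₂ * (k ^ 2 * (6 * C₁) * ‖v‖ₑ ^ 2)) (by finiteness) hfsum) hnfin
  refine ⟨u, hu, hun.trans ?_⟩
  calc _ ≤ C₃ * (C₂ * (k ^ 2 * (6 * C₁) * ‖v‖ₑ ^ 2) + C₁ * ‖v‖ₑ ^ 2) := by gcongr
    _ = _ := by ring

end Resolvent

/-! ### Approximate eigenfunctions -/

lemma summable_exp_neg_mul_abs_int {c : ℝ} (hc : 0 < c) :
    Summable fun n : ℤ => Real.exp (-c * |(n : ℝ)|) := by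
  have h : Summable fun n : ℕ => Real.exp (-c * |((n : ℤ) : ℝ)|) := by
    refine (Real.summable_exp_nat_mul_iff.2 (neg_lt_zero.2 hc)).congr fun n => ?_
    simp [mul_comm]
  refine Summable.of_nat_of_neg h (h.congr fun n => ?_)
  simp

/-- An exponentially decaying weight on the lattice of translations. -/
def latticeWeight (ε : ℝ) (p : ℤ × ℤ) : ℝ := Real.exp (-ε * (|(p.1 : ℝ)| + |(p.2 : ℝ)|))

lemma latticeWeight_pos (ε : ℝ) (p : ℤ × ℤ) : 0 < latticeWeight ε p := Real.exp_pos _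

lemma summable_latticeWeight_sq {ε : ℝ} (hε : 0 < ε) :
    Summable fun p => latticeWeight ε p ^ 2 := by
  have h := summable_exp_neg_mul_abs_int (c := 2 * ε) (by positivity)
  refine (h.mul_of_nonneg h (fun _ => (Real.exp_pos _).le) fun _ => (Real.exp_pos _).le).congr ?_
  intro p
  rw [latticeWeight, ← Real.exp_add, ← Real.exp_nat_mul]
  congr 1
  push_cast
  ring

/-- A unit step changes the exponent by at most `ε`, and `|e^x - 1| ≤ 2|x|` for `|x| ≤ 1`. So slow
damping barely disturbs a plane wave, relative to its size at each point. -/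
lemma abs_latticeWeight_sub_le {ε : ℝ} (hε : 0 < ε) (hε1 : ε ≤ 1) {p s : ℤ × ℤ}
    (hs : |(s.1 : ℝ)| + |(s.2 : ℝ)| ≤ 1) :
    |latticeWeight ε (p + s) - latticeWeight ε p| ≤ 2 * ε * latticeWeight ε p := by
  set d : ℝ := |((p + s).1 : ℝ)| + |((p + s).2 : ℝ)| - (|(p.1 : ℝ)| + |(p.2 : ℝ)|) with hd
  have hd1 : |d| ≤ 1 := by
    have a := abs_abs_sub_abs_le ((p + s).1 : ℝ) (p.1 : ℝ)
    have b := abs_abs_sub_abs_le ((p + s).2 : ℝ) (p.2 : ℝ)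
    have e1 : ((p + s).1 : ℝ) - p.1 = s.1 := by simp
    have e2 : ((p + s).2 : ℝ) - p.2 = s.2 := by simp
    rw [e1] at a
    rw [e2] at b
    calc |d| = |(|((p + s).1 : ℝ)| - |(p.1 : ℝ)|) + (|((p + s).2 : ℝ)| - |(p.2 : ℝ)|)| := by
          rw [hd]; congr 1; ring
      _ ≤ _ := abs_add_le _ _
      _ ≤ 1 := by linarith
  have e : latticeWeight ε (p + s) = Real.exp (-ε * d) * latticeWeight ε p := by
    rw [latticeWeight, latticeWeight, ← Real.exp_add, hd]
    congr 1
    ring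
  have hεd : |-ε * d| ≤ ε := by
    rw [abs_mul, abs_neg, abs_of_pos hε]
    nlinarith
  have h1 : |Real.exp (-ε * d) - 1| ≤ 2 * ε :=
    (Real.abs_exp_sub_one_le (hεd.trans hε1)).trans (by linarith)
  have hw := latticeWeight_pos ε p
  rw [e, show Real.exp (-ε * d) * latticeWeight ε p - latticeWeight ε p =
    (Real.exp (-ε * d) - 1) * latticeWeight ε p by ring, abs_mul, abs_of_pos hw]
  gcongr

/-- The plane wave with quasimomentum `(θ₁, θ₂)` on the lattice of translations. -/
def planeWave (θ₁ θ₂ : ℝ) (p : ℤ × ℤ) : ℂ := Complex.exp ((p.1 * θ₁ + p.2 * θ₂ : ℝ) * Complex.I)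

lemma planeWave_add (θ₁ θ₂ : ℝ) (p s : ℤ × ℤ) :
    planeWave θ₁ θ₂ (p + s) = planeWave θ₁ θ₂ p * planeWave θ₁ θ₂ s := by
  rw [planeWave, planeWave, planeWave, ← Complex.exp_add]
  congr 1
  push_cast [Prod.fst_add, Prod.snd_add]
  ring

lemma norm_planeWave (θ₁ θ₂ : ℝ) (p : ℤ × ℤ) : ‖planeWave θ₁ θ₂ p‖ = 1 :=
  Complex.norm_exp_ofReal_mul_I _

lemma planeWave_neg (θ₁ θ₂ : ℝ) (p : ℤ × ℤ) :
    planeWave θ₁ θ₂ (-p) = (starRingEnd ℂ) (planeWave θ₁ θ₂ p) := by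
  rw [planeWave, planeWave, ← Complex.exp_conj]
  congr 1
  simp
  ring

lemma sum_planeWave_shift (θ₁ θ₂ : ℝ) : ∑ t, planeWave θ₁ θ₂ (shift t) =
    1 + Complex.exp (θ₁ * Complex.I) + Complex.exp (θ₂ * Complex.I) := by
  simp [Fin.sum_univ_three, planeWave, shift]

lemma abs_shift_le (t : Fin 3) : |((shift t).1 : ℝ)| + |((shift t).2 : ℝ)| ≤ 1 := by
  fin_cases t <;> simp [shift]

/-- If `μ² = |1 + e^{iθ₁} + e^{iθ₂}|²`, then damped plane waves are approximate eigenfunctions of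
the adjacency matrix with eigenvalue `μ`. -/
lemma exists_approximate_eigenfunction {μ : ℂ} {θ₁ θ₂ : ℝ}
    (hμ : μ ^ 2 = ((‖1 + Complex.exp (θ₁ * Complex.I) + Complex.exp (θ₂ * Complex.I)‖ ^ 2 : ℝ) : ℂ))
    {δ : ℝ} (hδ : 0 < δ) : ∃ f : Vertex → ℂ, ∑' y, ‖f y‖ₑ ^ 2 ≠ ∞ ∧ ∑' y, ‖f y‖ₑ ^ 2 ≠ 0 ∧
      ∀ y : Vertex, ‖∑ t, f (y.neighbor t) - μ * f y‖ ≤ δ * ‖f y‖ := by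
  set F : ℂ := 1 + Complex.exp (θ₁ * Complex.I) + Complex.exp (θ₂ * Complex.I) with hF
  have hFF : F * (starRingEnd ℂ) F = μ ^ 2 := by
    rw [hμ, Complex.mul_conj, Complex.normSq_eq_norm_sq]
  -- The amplitude `c` on the `b`-vertices relative to the `a`-vertices makes `(1, c)` an
  -- eigenvector of the Bloch matrix with off-diagonal entries `F` and its conjugate. For `μ = 0`
  -- also `F = 0`, and any unimodular `c` serves.
  obtain ⟨c, hc, hcF, hFc⟩ : ∃ c : ℂ, ‖c‖ = 1 ∧ c * (starRingEnd ℂ) F = μ ∧ F = μ * c := by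
    by_cases h0 : μ = 0
    · have hF0 : F = 0 := by
        have : F * (starRingEnd ℂ) F = 0 := by rw [hFF, h0]; simp
        rcases mul_eq_zero.1 this with h | h
        · exact h
        · simpa using h
      exact ⟨1, by simp, by simp [hF0, h0], by simp [hF0, h0]⟩
    · refine ⟨F / μ, ?_, ?_, ?_⟩
      · have h2 : ‖μ‖ ^ 2 = ‖F‖ ^ 2 := by
          rw [← norm_pow, hμ, Complex.norm_real, Real.norm_of_nonneg (by positivity)]
        have h3 : ‖μ‖ = ‖F‖ := by
          rwa [sq_eq_sq₀ (norm_nonneg _) (norm_nonneg _)] at h2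
        rw [norm_div, h3, div_self]
        rw [← h3]
        exact norm_ne_zero_iff.2 h0
      · rw [div_mul_eq_mul_div, hFF]
        field_simp
      · field_simp
  -- Each of the three neighbours contributes an error of at most `2ε` times the weight.
  set ε := min 1 (δ / 6) with hε_def
  have hε : 0 < ε := by positivity
  have hε1 : ε ≤ 1 := min_le_left _ _
  have hεδ : 6 * ε ≤ δ := by linarith [min_le_right 1 (δ / 6)]
  set w := latticeWeight ε with hw
  set χ := planeWave θ₁ θ₂ with hχ
  have hχF : ∑ t, χ (shift t) = F := sum_planeWave_shift θ₁ θ₂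
  have hχF' : ∑ t, χ (-shift t) = (starRingEnd ℂ) F := by
    rw [← hχF, map_sum]
    exact Finset.sum_congr rfl fun t _ => planeWave_neg _ _ _
  -- Serves both sublattices: `b = c` with steps `-shift t` at the `a`-vertices, and `b = 1` with
  -- steps `shift t` at the `b`-vertices.
  have key : ∀ (p : ℤ × ℤ) (b : ℂ) (σ : Fin 3 → ℤ × ℤ), ‖b‖ = 1 →
      (∀ t, |((σ t).1 : ℝ)| + |((σ t).2 : ℝ)| ≤ 1) →
      ‖∑ t, b * ((w (p + σ t) : ℂ) * χ (p + σ t)) - b * (∑ t, χ (σ t)) * (w p * χ p)‖ ≤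
        δ * w p := by
    intro p b σ hb hσ
    have e : ∑ t, b * ((w (p + σ t) : ℂ) * χ (p + σ t)) - b * (∑ t, χ (σ t)) * (w p * χ p) =
        ∑ t, b * χ p * χ (σ t) * ((w (p + σ t) - w p : ℝ) : ℂ) := by
      rw [Finset.mul_sum, Finset.sum_mul, ← Finset.sum_sub_distrib]
      refine Finset.sum_congr rfl fun t _ => ?_
      rw [hχ, planeWave_add]
      push_cast
      ring
    rw [e]
    calc _ ≤ ∑ t : Fin 3, 2 * ε * w p := by
          refine norm_sum_le_of_le _ fun t _ => ?_
          rw [norm_mul, norm_mul, norm_mul, hb, norm_planeWave, norm_planeWave, Complex.norm_real]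
          simpa using abs_latticeWeight_sub_le hε hε1 (hσ t)
      _ = 6 * ε * w p := by simp; ring
      _ ≤ δ * w p := by
          gcongr
          exact (latticeWeight_pos ε p).le
  set f : Vertex → ℂ := fun y => match y with
    | .a p => w p * χ p
    | .b p => c * (w p * χ p) with hf
  have hfa : ∀ p, f (.a p) = w p * χ p := fun _ => rfl
  have hfb : ∀ p, f (.b p) = c * (w p * χ p) := fun _ => rfl
  have hna : ∀ p, ‖f (.a p)‖ = w p := fun p => by
    rw [hfa, norm_mul, norm_planeWave, mul_one, Complex.norm_real,
      Real.norm_of_nonneg (latticeWeight_pos ε p).le]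
  have hnb : ∀ p, ‖f (.b p)‖ = w p := fun p => by
    rw [hfb, norm_mul, hc, one_mul, ← hfa, hna]
  refine ⟨f, ?_, ?_, ?_⟩
  · have hs : ∑' p, ENNReal.ofReal (w p ^ 2) ≠ ∞ :=
      (summable_latticeWeight_sq hε).tsum_ofReal_ne_top
    have ea : ∀ p, ‖f (.a p)‖ₑ ^ 2 = ENNReal.ofReal (w p ^ 2) := fun p => by
      rw [← ofReal_norm, hna, ENNReal.ofReal_pow (latticeWeight_pos ε p).le]
    have eb : ∀ p, ‖f (.b p)‖ₑ ^ 2 = ENNReal.ofReal (w p ^ 2) := fun p => by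
      rw [← ofReal_norm, hnb, ENNReal.ofReal_pow (latticeWeight_pos ε p).le]
    rw [tsum_vertex]
    simp only [ea, eb]
    exact ENNReal.add_ne_top.2 ⟨hs, hs⟩
  · rw [Ne, ENNReal.tsum_eq_zero]
    intro h
    have := h (.a 0)
    rw [pow_eq_zero_iff two_ne_zero, enorm_eq_zero, ← norm_eq_zero, hna] at this
    exact (latticeWeight_pos ε 0).ne' this
  · rintro (p | p)
    · have := key p c (fun t => -shift t) hc fun t => by simpa using abs_shift_le t
      rw [hχF', hcF] at this
      rw [hna]
      simpa only [Vertex.neighbor, hfa, hfb, sub_eq_add_neg] using this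
    · have := key p 1 shift (by simp) abs_shift_le
      rw [hχF, hFc] at this
      rw [hnb]
      refine le_trans (le_of_eq ?_) this
      simp only [Vertex.neighbor, hfa, hfb]
      congr 1
      simp only [one_mul]
      ring

/-- A function with zero boundary values and prescribed derivatives at the end points. -/
lemma exists_isH2_of_derivs : ∃ C : ℝ≥0∞, C ≠ ∞ ∧ ∀ c d : ℂ, ∃ W W' W'' : ℝ → ℂ,
    IsH2 W W' W'' ∧ W 0 = 0 ∧ W 1 = 0 ∧ W' 0 = c ∧ W' 1 = d ∧
      h2NormSq W W' W'' ≤ C * (‖c‖ₑ ^ 2 + ‖d‖ₑ ^ 2) := by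
  obtain ⟨A, A', A'', hA, hA0, hA1, hA0', hA1'⟩ : ∃ A A' A'' : ℝ → ℂ,
      IsH2 A A' A'' ∧ A 0 = 0 ∧ A 1 = 0 ∧ A' 0 = 1 ∧ A' 1 = 0 := by
    -- The cubic `x (1 - x)²`; its negated reflection below serves for the other end point.
    refine ⟨fun x => ((x - 2 * x ^ 2 + x ^ 3 : ℝ) : ℂ), fun x => ((1 - 4 * x + 3 * x ^ 2 : ℝ) : ℂ),
      fun x => ((-4 + 6 * x : ℝ) : ℂ), IsH2.of_hasDerivAt (fun x => HasDerivAt.ofReal_comp ?_)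
        (fun x => HasDerivAt.ofReal_comp ?_) (by fun_prop), by norm_num, by norm_num, by norm_num,
        by norm_num⟩
    · refine (((hasDerivAt_id x).sub ((hasDerivAt_pow 2 x).const_mul 2)).add
        (hasDerivAt_pow 3 x)).congr_deriv ?_
      push_cast
      ring
    · refine ((((hasDerivAt_const x (1 : ℝ)).sub ((hasDerivAt_id x).const_mul 4))).add
        ((hasDerivAt_pow 2 x).const_mul 3)).congr_deriv ?_
      push_cast
      ring
  obtain ⟨B, B', B'', hB, hB0, hB1, hB0', hB1'⟩ : ∃ B B' B'' : ℝ → ℂ,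
      IsH2 B B' B'' ∧ B 0 = 0 ∧ B 1 = 0 ∧ B' 0 = 0 ∧ B' 1 = 1 := by
    refine ⟨fun x => -A (1 - x), fun x => A' (1 - x), fun x => -A'' (1 - x), ?_, by simp [hA1],
      by simp [hA0], by simp [hA1'], by simp [hA0']⟩
    have := hA.comp_one_sub.smul (-1)
    convert this using 1 <;> ext x <;> simp
  refine ⟨2 * h2NormSq A A' A'' + 2 * h2NormSq B B' B'', ?_, fun c d =>
    ⟨_, _, _, (hA.smul c).add (hB.smul d), by simp [hA0, hB0], by simp [hA1, hB1],
      by simp [hA0', hB0'], by simp [hA1', hB1'], ?_⟩⟩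
  · have := hA.norm_lt_top
    have := hB.norm_lt_top
    finiteness
  · refine (hA.smul c).h2NormSq_add_le.trans ?_
    rw [IsH2.h2NormSq_smul, IsH2.h2NormSq_smul]
    set a := h2NormSq A A' A''
    set b := h2NormSq B B' B''
    calc _ ≤ (2 * (‖c‖ₑ ^ 2 * a) + 2 * (‖d‖ₑ ^ 2 * b)) +
          (2 * (‖d‖ₑ ^ 2 * a) + 2 * (‖c‖ₑ ^ 2 * b)) := le_self_add
      _ = _ := by ring

/-- The differential expression maps square summable `H²`-families to `L²(G)`. -/
lemma exists_lp_operator {q : ℝ → ℝ} (hq : MemLp q 2 edgeMeasure) (z : ℂ) :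
    ∃ C : ℝ≥0∞, C ≠ ∞ ∧ ∀ W W' W'' : Edge → ℝ → ℂ, (∀ e, IsH2 (W e) (W' e) (W'' e)) →
      ∑' e, h2NormSq (W e) (W' e) (W'' e) ≠ ∞ → ∃ v : GraphL2,
      (∀ e, v e =ᵐ[edgeMeasure] fun x => -W'' e x + q x * W e x - z * W e x) ∧
      ‖v‖ₑ ^ 2 ≤ C * ∑' e, h2NormSq (W e) (W' e) (W'' e) := by
  set A := 2 + 4 * ∫⁻ x, ‖q x‖ₑ ^ 2 ∂edgeMeasure with hA
  have hAt : A ≠ ∞ := by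
    have := potential_sq_lt_top hq
    finiteness
  refine ⟨2 * A + 2 * ‖z‖ₑ ^ 2, by finiteness, fun W W' W'' hW hn => ?_⟩
  have hm : ∀ e, MemLp (fun x => -W'' e x + q x * W e x - z * W e x) 2 edgeMeasure := fun e =>
    ((hW e).operator_memLp hq).sub ((hW e).memLp_self.const_mul z)
  have hle : ∀ e, ‖(hm e).toLp‖ₑ ^ 2 ≤
      (2 * A + 2 * ‖z‖ₑ ^ 2) * h2NormSq (W e) (W' e) (W'' e) := by
    intro e
    rw [enorm_sq_eq_lintegral (hm e).coeFn_toLp]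
    have m := ((hW e).operator_memLp hq).aestronglyMeasurable.enorm
    calc ∫⁻ x, ‖-W'' e x + q x * W e x - z * W e x‖ₑ ^ 2 ∂edgeMeasure
        ≤ ∫⁻ x, (2 * ‖-W'' e x + q x * W e x‖ₑ ^ 2 + 2 * ‖z‖ₑ ^ 2 * ‖W e x‖ₑ ^ 2)
            ∂edgeMeasure := by
          refine lintegral_mono fun x => ?_
          simp only [sub_eq_add_neg _ (z * W e x)]
          refine (enorm_add_sq_le _ _).trans (le_of_eq ?_)
          rw [enorm_neg, enorm_mul]
          ring
      _ = 2 * ∫⁻ x, ‖-W'' e x + q x * W e x‖ₑ ^ 2 ∂edgeMeasure +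
            2 * ‖z‖ₑ ^ 2 * ∫⁻ x, ‖W e x‖ₑ ^ 2 ∂edgeMeasure := by
          rw [lintegral_add_left' (by fun_prop), lintegral_const_mul' _ _ (by norm_num),
            lintegral_const_mul' _ _ (by finiteness)]
      _ ≤ 2 * (A * h2NormSq (W e) (W' e) (W'' e)) +
            2 * ‖z‖ₑ ^ 2 * h2NormSq (W e) (W' e) (W'' e) := by
          gcongr
          · exact (hW e).operator_le
          · exact lintegral_enorm_sq_le_h2NormSq _ _ _
      _ = _ := by ring
  have ht := ENNReal.tsum_le_tsum hle
  rw [ENNReal.tsum_mul_left] at ht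
  refine ⟨⟨fun e => (hm e).toLp, memℓp_two_of_tsum_ne_top (ne_top_of_le_ne_top
    (by finiteness) ht)⟩, fun e => (hm e).coeFn_toLp, ?_⟩
  rw [enorm_sq_eq_tsum]
  exact ht

/-! ### From a bounded resolvent to an estimate on the vertices, and its contradiction. -/

section Spectrum

variable {q : ℝ → ℝ} {z : ℂ} {φ φ' : ℝ → ℂ}

/-- The boundary values of a solution are controlled by its `L²`-norm. -/
lemma IsSolution.exists_ends_le (heven : ∀ᵐ x ∂edgeMeasure, q x = q (1 - x))
    (h : IsSolution q z φ φ') (h0 : φ 0 = 0) (h1 : φ 1 = 1) : ∃ C : ℝ≥0∞, C ≠ ∞ ∧ ∀ c d : ℂ,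
      ‖c‖ₑ ^ 2 + ‖d‖ₑ ^ 2 ≤ C * ∫⁻ x, ‖c * φ (1 - x) + d * φ x‖ₑ ^ 2 ∂edgeMeasure := by
  obtain ⟨ψ'', hψ, -⟩ := h.comp_one_sub heven
  obtain ⟨φ'', hφ, -⟩ := h
  set Φ : EdgeL2 := hφ.memLp_self.toLp
  set Ψ : EdgeL2 := hψ.memLp_self.toLp
  set L : ℂ × ℂ →ₗ[ℂ] EdgeL2 :=
    (LinearMap.toSpanSingleton ℂ EdgeL2 Ψ).coprod (LinearMap.toSpanSingleton ℂ EdgeL2 Φ) with hL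
  have hLae : ∀ c d : ℂ, L (c, d) =ᵐ[edgeMeasure] fun x => c * φ (1 - x) + d * φ x := by
    intro c d
    have e : L (c, d) = c • Ψ + d • Φ := by simp [hL]
    rw [e]
    filter_upwards [Lp.coeFn_add (c • Ψ) (d • Φ), Lp.coeFn_smul c Ψ, Lp.coeFn_smul d Φ,
      hφ.memLp_self.coeFn_toLp, hψ.memLp_self.coeFn_toLp] with x a b i j k
    rw [a, Pi.add_apply, b, i, Pi.smul_apply, Pi.smul_apply, j, k]
    rfl
  -- A combination that vanishes in `L²` vanishes at both end points by continuity, where its values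
  -- are `c` and `d`. An injective linear map on a finite-dimensional space is bounded below.
  have hinj : LinearMap.ker L = ⊥ := by
    rw [LinearMap.ker_eq_bot']
    rintro ⟨c, d⟩ hcd
    have hae := hLae c d
    rw [hcd] at hae
    have e := ((hψ.smul c).add (hφ.smul d)).eqOn_zero (hae.symm.trans (Lp.coeFn_zero ..))
    have e0 := e (left_mem_Icc.2 zero_le_one)
    have e1 := e (right_mem_Icc.2 zero_le_one)
    simp [h0, h1] at e0 e1
    simp [e0, e1]
  obtain ⟨K, -, hK⟩ := L.exists_antilipschitzWith hinj
  refine ⟨2 * (K : ℝ≥0∞) ^ 2, by finiteness, fun c d => ?_⟩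
  rw [← enorm_sq_eq_lintegral (hLae c d)]
  have hb : ‖(c, d)‖ ≤ K * ‖L (c, d)‖ := by
    have := hK.le_mul_dist (c, d) 0
    simpa using this
  have hb' : ‖(c, d)‖ₑ ≤ K * ‖L (c, d)‖ₑ := by
    have hb2 : ‖(c, d)‖₊ ≤ K * ‖L (c, d)‖₊ := by exact_mod_cast hb
    simp only [enorm_eq_nnnorm]
    exact_mod_cast hb2
  have hc : ‖c‖ₑ ≤ K * ‖L (c, d)‖ₑ := (enorm_le_iff_norm_le.2 (norm_fst_le (c, d))).trans hb'
  have hd : ‖d‖ₑ ≤ K * ‖L (c, d)‖ₑ := (enorm_le_iff_norm_le.2 (norm_snd_le (c, d))).trans hb'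
  calc ‖c‖ₑ ^ 2 + ‖d‖ₑ ^ 2 ≤ (K * ‖L (c, d)‖ₑ) ^ 2 + (K * ‖L (c, d)‖ₑ) ^ 2 := by gcongr
    _ = _ := by ring

/-- In the resolvent set of the Hamiltonian, the difference equation on the vertices satisfies an
a priori estimate. -/
lemma exists_vertex_estimate (hq : MemLp q 2 edgeMeasure)
    (heven : ∀ᵐ x ∂edgeMeasure, q x = q (1 - x)) (h : IsSolution q z φ φ') (h0 : φ 0 = 0)
    (h1 : φ 1 = 1) (hz : z ∈ resolventSet (hamiltonian q)) : ∃ C : ℝ≥0∞, C ≠ ∞ ∧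
      ∀ f r : Vertex → ℂ, ∑' y, ‖f y‖ₑ ^ 2 ≠ ∞ → ∑' y, ‖r y‖ₑ ^ 2 ≠ ∞ →
        (∀ y, ∑ t, f (y.neighbor t) - 3 * (φ' 1 / φ' 0) * f y = r y) →
        ∑' y, ‖f y‖ₑ ^ 2 ≤ C * ∑' y, ‖r y‖ₑ ^ 2 := by
  have hκ := h.deriv_zero_ne hq h0 h1
  obtain ⟨R, -, hR⟩ := (mem_resolventSet_iff_graph (hamiltonian_graph q)).1 hz
  obtain ⟨C₁, hC₁, hW⟩ := exists_isH2_of_derivs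
  obtain ⟨C₂, hC₂, hop⟩ := exists_lp_operator hq z
  obtain ⟨C₃, hC₃, hends⟩ := h.exists_ends_le heven h0 h1
  obtain ⟨_, -, hext⟩ := exists_mem_hamiltonianGraph heven h h0 h1 hκ
  set k := ‖φ' 0 / 3‖ₑ ^ 2 with hk
  have hkt : k ≠ ∞ := by finiteness
  refine ⟨C₃ * (2 * (‖R‖ₑ ^ 2 * C₂) + 2) * (C₁ * k * 3), by finiteness,
    fun f r hf hr hfr => ?_⟩
  -- On each edge `W` vanishes at the ends and its outgoing derivative there is `-φ'(0)/3` times the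
  -- vertex value of `r`. The three edges at a vertex then cancel the flux `φ'(0) r` of the glued
  -- function.
  choose W W' W'' hH2 hW0 hW1 hd0 hd1 hn using
    fun e : Edge => hW (-(φ' 0 / 3 * r e.source)) (φ' 0 / 3 * r e.target)
  have hWsum : ∑' e, h2NormSq (W e) (W' e) (W'' e) ≤ C₁ * k * 3 * ∑' y, ‖r y‖ₑ ^ 2 := by
    rw [mul_assoc _ 3, ← tsum_ends fun y => ‖r y‖ₑ ^ 2, ← ENNReal.tsum_mul_left]
    refine ENNReal.tsum_le_tsum fun e => (hn e).trans (le_of_eq ?_)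
    rw [enorm_neg, enorm_mul, enorm_mul, hk]
    ring
  have hWt := ne_top_of_le_ne_top (b := C₁ * k * 3 * ∑' y, ‖r y‖ₑ ^ 2) (by finiteness) hWsum
  obtain ⟨v, hv, hvn⟩ := hop W W' W'' hH2 hWt
  obtain ⟨u, hu, -, huae⟩ := hext f W W' W'' v hH2 hW0 hW1 hv (fun y => by
    rw [hfr y]
    cases y with
    | a p =>
      simp [Vertex.sign, Vertex.coord, Vertex.edge, hd0, Edge.source]
      ring
    | b p =>
      simp [Vertex.sign, Vertex.coord, Vertex.edge, hd1, Edge.target]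
      ring) hf hWt
  -- The glued part is annihilated by the differential expression minus `z`, so `v` comes from `W`
  -- alone and its norm is controlled by that of `r`.
  have huv : R v = u := by simpa using hR _ hu
  have hun : ‖u‖ₑ ^ 2 ≤ ‖R‖ₑ ^ 2 * C₂ * ∑' e, h2NormSq (W e) (W' e) (W'' e) := by
    calc ‖u‖ₑ ^ 2 ≤ (‖R‖ₑ * ‖v‖ₑ) ^ 2 := by
          rw [← huv]
          gcongr
          exact R.le_opENorm v
      _ = ‖R‖ₑ ^ 2 * ‖v‖ₑ ^ 2 := by ring
      _ ≤ ‖R‖ₑ ^ 2 * (C₂ * ∑' e, h2NormSq (W e) (W' e) (W'' e)) := by gcongr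
      _ = _ := by ring
  -- The values of `f` are recovered from the glued part `u - W` by `IsSolution.exists_ends_le`.
  have hedge : ∀ e : Edge, ‖f e.source‖ₑ ^ 2 + ‖f e.target‖ₑ ^ 2 ≤
      C₃ * (2 * ‖u e‖ₑ ^ 2 + 2 * h2NormSq (W e) (W' e) (W'' e)) := by
    intro e
    refine (hends _ _).trans (mul_le_mul_right ?_ _)
    have m := (Lp.aestronglyMeasurable (u e)).enorm
    calc ∫⁻ x, ‖f e.source * φ (1 - x) + f e.target * φ x‖ₑ ^ 2 ∂edgeMeasure
        ≤ ∫⁻ x, (2 * ‖u e x‖ₑ ^ 2 + 2 * ‖W e x‖ₑ ^ 2) ∂edgeMeasure := by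
          refine lintegral_mono_ae ?_
          filter_upwards [huae e] with x hx
          have : f e.source * φ (1 - x) + f e.target * φ x = u e x + -W e x := by
            rw [hx]
            ring
          rw [this]
          refine (enorm_add_sq_le _ _).trans (le_of_eq ?_)
          rw [enorm_neg]
      _ = 2 * ‖u e‖ₑ ^ 2 + 2 * ∫⁻ x, ‖W e x‖ₑ ^ 2 ∂edgeMeasure := by
          rw [lintegral_add_left' (by fun_prop), lintegral_const_mul' _ _ (by norm_num),
            lintegral_const_mul' _ _ (by norm_num),
            ← enorm_sq_eq_lintegral (Filter.EventuallyEq.refl _ (u e))]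
      _ ≤ _ := by
          gcongr
          exact lintegral_enorm_sq_le_h2NormSq _ _ _
  calc ∑' y, ‖f y‖ₑ ^ 2 ≤ 3 * ∑' y, ‖f y‖ₑ ^ 2 :=
        le_mul_of_one_le_left zero_le (by norm_num)
    _ = ∑' e : Edge, (‖f e.source‖ₑ ^ 2 + ‖f e.target‖ₑ ^ 2) :=
        (tsum_ends fun y => ‖f y‖ₑ ^ 2).symm
    _ ≤ ∑' e, C₃ * (2 * ‖u e‖ₑ ^ 2 + 2 * h2NormSq (W e) (W' e) (W'' e)) :=
        ENNReal.tsum_le_tsum hedge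
    _ = C₃ * (2 * ‖u‖ₑ ^ 2 + 2 * ∑' e, h2NormSq (W e) (W' e) (W'' e)) := by
        rw [ENNReal.tsum_mul_left, ENNReal.tsum_add, ENNReal.tsum_mul_left,
          ENNReal.tsum_mul_left, ← enorm_sq_eq_tsum]
    _ ≤ C₃ * (2 * (‖R‖ₑ ^ 2 * C₂ * ∑' e, h2NormSq (W e) (W' e) (W'' e)) +
          2 * ∑' e, h2NormSq (W e) (W' e) (W'' e)) := by gcongr
    _ = C₃ * (2 * (‖R‖ₑ ^ 2 * C₂) + 2) * ∑' e, h2NormSq (W e) (W' e) (W'' e) := by ring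
    _ ≤ C₃ * (2 * (‖R‖ₑ ^ 2 * C₂) + 2) * (C₁ * k * 3 * ∑' y, ‖r y‖ₑ ^ 2) := by gcongr
    _ = _ := by ring

/-- In the resolvent set the vertex estimate would hold with some `C`; damped plane waves with
defect `δ` so small that `C δ² < 1` contradict it. -/
lemma mem_spectrum_hamiltonian (hq : MemLp q 2 edgeMeasure)
    (heven : ∀ᵐ x ∂edgeMeasure, q x = q (1 - x)) (h : IsSolution q z φ φ') (h0 : φ 0 = 0)
    (h1 : φ 1 = 1) {θ₁ θ₂ : ℝ} (hθ : (3 * (φ' 1 / φ' 0)) ^ 2 =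
      ((‖1 + Complex.exp (θ₁ * Complex.I) + Complex.exp (θ₂ * Complex.I)‖ ^ 2 : ℝ) : ℂ)) :
    z ∈ spectrum (hamiltonian q) := by
  intro hz
  obtain ⟨C, hC, hest⟩ := exists_vertex_estimate hq heven h h0 h1 hz
  lift C to NNReal using hC
  obtain ⟨δ, hδ, hδC⟩ : ∃ δ : NNReal, 0 < δ ∧ C * δ ^ 2 < 1 := by
    refine ⟨(C + 1)⁻¹, by positivity, ?_⟩
    have hC1 : 1 ≤ C + 1 := le_add_self
    rw [inv_pow, ← div_eq_mul_inv, div_lt_one (by positivity)]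
    calc C < C + 1 := lt_add_one C
      _ ≤ (C + 1) ^ 2 := le_self_pow₀ hC1 two_ne_zero
  obtain ⟨f, hf, hf0, hfδ⟩ := exists_approximate_eigenfunction hθ (δ := δ) hδ
  have hr : ∑' y : Vertex, ‖∑ t, f (y.neighbor t) - 3 * (φ' 1 / φ' 0) * f y‖ₑ ^ 2 ≤
      (δ : ℝ≥0∞) ^ 2 * ∑' y, ‖f y‖ₑ ^ 2 := by
    rw [← ENNReal.tsum_mul_left]
    refine ENNReal.tsum_le_tsum fun y => ?_
    rw [← mul_pow]
    gcongr
    have : ‖∑ t, f (y.neighbor t) - 3 * (φ' 1 / φ' 0) * f y‖₊ ≤ δ * ‖f y‖₊ := by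
      exact_mod_cast hfδ y
    simp only [enorm_eq_nnnorm]
    exact_mod_cast this
  have hle := hest f _ hf (ne_top_of_le_ne_top (b := (δ : ℝ≥0∞) ^ 2 * ∑' y, ‖f y‖ₑ ^ 2)
    (by finiteness) hr) fun y => rfl
  have hlt : (C : ℝ≥0∞) * ((δ : ℝ≥0∞) ^ 2 * ∑' y, ‖f y‖ₑ ^ 2) < ∑' y, ‖f y‖ₑ ^ 2 := by
    rw [← mul_assoc]
    calc _ < 1 * ∑' y, ‖f y‖ₑ ^ 2 := by
          refine ENNReal.mul_lt_mul_left hf0 hf ?_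
          exact_mod_cast hδC
      _ = _ := one_mul _
  exact absurd (hle.trans (by gcongr)) (not_le.2 hlt)

end Spectrum

/-! ### The dispersion relation -/

lemma norm_sq_dispersion (θ₁ θ₂ : ℝ) :
    ‖1 + Complex.exp (θ₁ * Complex.I) + Complex.exp (θ₂ * Complex.I)‖ ^ 2 =
      1 + 8 * Real.cos ((θ₁ - θ₂) / 2) * Real.cos (θ₁ / 2) * Real.cos (θ₂ / 2) := by
  have e : 1 + Complex.exp (θ₁ * Complex.I) + Complex.exp (θ₂ * Complex.I) =
      ((1 + Real.cos θ₁ + Real.cos θ₂ : ℝ) : ℂ) +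
        ((Real.sin θ₁ + Real.sin θ₂ : ℝ) : ℂ) * Complex.I := by
    rw [Complex.exp_mul_I, Complex.exp_mul_I]
    push_cast
    ring
  rw [e, ← Complex.normSq_eq_norm_sq, Complex.normSq_add_mul_I]
  obtain ⟨a, rfl⟩ : ∃ a, θ₁ = 2 * a := ⟨θ₁ / 2, by ring⟩
  obtain ⟨b, rfl⟩ : ∃ b, θ₂ = 2 * b := ⟨θ₂ / 2, by ring⟩
  rw [show (2 * a - 2 * b) / 2 = a - b by ring, mul_div_cancel_left₀ _ two_ne_zero,
    mul_div_cancel_left₀ _ two_ne_zero, Real.cos_sub, Real.cos_two_mul, Real.cos_two_mul,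
    Real.sin_two_mul, Real.sin_two_mul]
  have ha := Real.sin_sq_add_cos_sq a
  have hb := Real.sin_sq_add_cos_sq b
  linear_combination (4 * Real.cos a ^ 2) * ha + (4 * Real.cos b ^ 2) * hb

/-- The antidiagonal `θ = (t, -t)` suffices: there the sum is the real number `1 + 2 cos t`, and `t`
can be chosen to make it equal to `|r|`, since `(|r| - 1) / 2` lies in `[-1, 1]`. -/
lemma exists_dispersion {r : ℝ} (hr : |r| ≤ 3) : ∃ θ₁ ∈ Icc (-Real.pi) Real.pi,
    ∃ θ₂ ∈ Icc (-Real.pi) Real.pi,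
      r ^ 2 = ‖1 + Complex.exp (θ₁ * Complex.I) + Complex.exp (θ₂ * Complex.I)‖ ^ 2 := by
  set t := Real.arccos ((|r| - 1) / 2) with ht
  have hcos : Real.cos t = (|r| - 1) / 2 :=
    Real.cos_arccos (by linarith [abs_nonneg r]) (by linarith)
  have ht0 : 0 ≤ t := Real.arccos_nonneg _
  have htπ : t ≤ Real.pi := Real.arccos_le_pi _
  refine ⟨t, ⟨by linarith, htπ⟩, -t, ⟨by linarith, by linarith⟩, ?_⟩
  have e : 1 + Complex.exp (t * Complex.I) + Complex.exp ((-t : ℝ) * Complex.I) =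
      ((1 + 2 * Real.cos t : ℝ) : ℂ) := by
    push_cast
    rw [Complex.exp_mul_I, Complex.exp_mul_I, Complex.cos_neg, Complex.sin_neg]
    ring
  rw [e, hcos, Complex.norm_real, Real.norm_eq_abs, sq_abs, ← sq_abs r]
  ring

lemma mem_spectrum_hamiltonian_iff {q : ℝ → ℝ} {z : ℂ} {φ φ' : ℝ → ℂ}
    (hq : MemLp q 2 edgeMeasure) (heven : ∀ᵐ x ∂edgeMeasure, q x = q (1 - x))
    (hz : z ∉ spectrum (dirichletOperator q)) (h : IsSolution q z φ φ') (h0 : φ 0 = 0)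
    (h1 : φ 1 = 1) : z ∈ spectrum (hamiltonian q) ↔
      ∃ θ₁ ∈ Icc (-Real.pi) Real.pi, ∃ θ₂ ∈ Icc (-Real.pi) Real.pi,
        9 * (φ' 1 / φ' 0) ^ 2 =
          ((‖1 + Complex.exp (θ₁ * Complex.I) + Complex.exp (θ₂ * Complex.I)‖ ^ 2 : ℝ) : ℂ) := by
  constructor
  · intro hs
    obtain ⟨r, hr, he⟩ := mem_spectrum_adjacency (μ := 3 * (φ' 1 / φ' 0)) (by
      by_contra hμ
      exact hs (mem_resolventSet_hamiltonian hq heven hz h h0 h1 hμ))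
    obtain ⟨θ₁, hθ₁, θ₂, hθ₂, hθ⟩ := exists_dispersion hr
    refine ⟨θ₁, hθ₁, θ₂, hθ₂, ?_⟩
    rw [← hθ, Complex.ofReal_pow, ← he]
    ring
  · rintro ⟨θ₁, -, θ₂, -, hθ⟩
    exact mem_spectrum_hamiltonian hq heven h h0 h1 (by rw [← hθ]; ring)

end Graphene

end

theorem mainTheorem8 (q : ℝ → ℝ) (hq : MeasureTheory.MemLp q 2 Graphene.edgeMeasure)
    (heven : ∀ᵐ x ∂Graphene.edgeMeasure, q x = q (1 - x))
    (z : ℂ) (hz : z ∉ Graphene.spectrum (Graphene.dirichletOperator q)) :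
    (∃ φ φ' : ℝ → ℂ, Graphene.IsSolution q z φ φ' ∧ φ 0 = 0 ∧ φ 1 = 1) ∧
    (∃! M : Matrix (Fin 2) (Fin 2) ℂ, Graphene.IsMonodromy q z M) ∧
    ∀ (φ φ' : ℝ → ℂ), Graphene.IsSolution q z φ φ' → φ 0 = 0 → φ 1 = 1 →
      φ' 0 ≠ 0 ∧
      (∀ M : Matrix (Fin 2) (Fin 2) ℂ, Graphene.IsMonodromy q z M →
        φ' 1 / φ' 0 = M.trace / 2) ∧
      (z ∈ Graphene.spectrum (Graphene.hamiltonian q) ↔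
        ∃ θ₁ ∈ Set.Icc (-Real.pi) Real.pi, ∃ θ₂ ∈ Set.Icc (-Real.pi) Real.pi,
          9 * (φ' 1 / φ' 0) ^ 2 =
            ((‖1 + Complex.exp (θ₁ * Complex.I) + Complex.exp (θ₂ * Complex.I)‖ ^ 2 : ℝ) : ℂ)) ∧
      (z ∈ Graphene.spectrum (Graphene.hamiltonian q) ↔
        ∃ θ₁ ∈ Set.Icc (-Real.pi) Real.pi, ∃ θ₂ ∈ Set.Icc (-Real.pi) Real.pi,
          9 * (φ' 1 / φ' 0) ^ 2 =
            ((1 + 8 * Real.cos ((θ₁ - θ₂) / 2) * Real.cos (θ₁ / 2) * Real.cos (θ₂ / 2) : ℝ)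
              : ℂ)) := by
  obtain ⟨φ₁, φ₁', h, h0, h1⟩ := Graphene.exists_solution hq hz
  refine ⟨⟨φ₁, φ₁', h, h0, h1⟩, ⟨_, (Graphene.isMonodromy_iff hq heven hz h h0 h1 _).2 rfl,
    fun M hM => (Graphene.isMonodromy_iff hq heven hz h h0 h1 M).1 hM⟩, ?_⟩
  intro φ φ' k k0 k1
  have hs := Graphene.mem_spectrum_hamiltonian_iff hq heven hz k k0 k1
  refine ⟨k.deriv_zero_ne hq k0 k1, fun M hM => ?_, hs, ?_⟩
  · rw [(Graphene.isMonodromy_iff hq heven hz k k0 k1 M).1 hM, Matrix.trace_fin_two_of]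
    ring
  · simp only [hs, Graphene.norm_sq_dispersion]
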